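/- For $\beta>0$ and $N\ge 0$ let C$\beta$E$_N$ denote the circular $\beta$ ensemble, i.e. the probability law of angles $\theta_1,\dots,\theta_N\in(-\pi,\pi]$ with density proportional to $\prod_{1\le j<k\le N}|e^{i\theta_k}-e^{i\theta_j}|^{\beta}$, and let $\langle\cdot\rangle_{{\rm C}\beta{\rm E}_N}$ be the corresponding average. Let $G$ be the Barnes $G$-function, $$G(1+w)=(2\pi)^{w/2}\,e^{-(w+(1+\gamma)w^2)/2}\prod_{k=1}^{\infty}\Big(1+\frac wk\Big)^{k}e^{w^2/(2k)-w},$$ with $\gamma$ Euler's constant. Let $\beta/2=s/r$ with positive integers $r,s$, and let $q,b\in\mathbb C$ with $\beta\,{\rm Re}\,q>-1$. Then for every $N$ the function $\prod_{l=1}^{N}e^{i\beta b\theta_l/2}|1+e^{i\theta_l}|^{\beta q}$ is integrable with respect to C$\beta$E$_N$, and as $n\to\infty$ $$\Big\langle\prod_{l=1}^{rn}e^{i\beta b\theta_l/2}\,|1+e^{i\theta_l}|^{\beta q}\Big\rangle_{{\rm C}\beta{\rm E}_{rn}}\sim (rn)^{(\beta/2)(q^2-b^2)}A_{q,b},$$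 where $$A_{q,b}=r^{-(q^2-b^2)\beta/2}\prod_{\nu=0}^{r-1}\prod_{p=0}^{s-1}\frac{G\big(\frac{q+b}{r}+\frac{\nu}{r}-\frac ps+1\big)\,G\big(\frac{q-b}{r}+\frac{\nu}{r}-\frac ps+1\big)}{G\big(\frac{2q}{r}+\frac{\nu}{r}-\frac ps+1\big)\,G\big(\frac{\nu}{r}-\frac ps+1\big)}.$$ Here $u_n\sim v_n$ means $u_n-v_n=o(v_n)$: the quotient tends to $1$ when $A_{q,b}\ne0$, and the averages vanish for all large $n$ when $A_{q,b}=0$. -/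

import Mathlib

open MeasureTheory Filter Asymptotics

noncomputable section

namespace CircularBeta

/-- The Boltzmann factor `∏_{j < k} |e^{i θ_k} - e^{i θ_j}|^β` of the log-gas on the circle. -/
def boltzmannFactor (β : ℝ) (n : ℕ) (θ : Fin n → ℝ) : ℝ :=
  ∏ j : Fin n, ∏ k ∈ Finset.Ioi j,
    ‖Complex.exp (Complex.I * θ k) - Complex.exp (Complex.I * θ j)‖ ^ β

/-- The unnormalised measure `∏_{j < k} |e^{i θ_k} - e^{i θ_j}|^β dθ_1 ⋯ dθ_n` on the cube
`-π < θ_l ≤ π`. -/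
def boltzmannMeasure (β : ℝ) (n : ℕ) : Measure (Fin n → ℝ) :=
  (volume.restrict (Set.univ.pi fun _ => Set.Ioc (-Real.pi) Real.pi)).withDensity
    fun θ => ENNReal.ofReal (boltzmannFactor β n θ)

/-- The circular `β` ensemble of `n` eigenvalue angles: the probability law on the cube
`-π < θ_l ≤ π` whose density is proportional to `∏_{j < k} |e^{i θ_k} - e^{i θ_j}|^β`. -/
def ensemble (β : ℝ) (n : ℕ) : Measure (Fin n → ℝ) :=
  (boltzmannMeasure β n Set.univ)⁻¹ • boltzmannMeasure β n

/-- The symbol `e^{i β b θ / 2} |1 + e^{i θ}|^{β q}`. -/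
def symbol (β : ℝ) (q b : ℂ) (θ : ℝ) : ℂ :=
  Complex.exp (Complex.I * β * b * θ / 2) *
    ((‖1 + Complex.exp (Complex.I * θ)‖ : ℝ) : ℂ) ^ ((β : ℂ) * q)

/-- The Barnes `G`-function through its Weierstrass product: for `w = z - 1`,
`G(1 + w) = (2π)^{w/2} exp(-(w + (1 + γ) w²)/2) ∏_{k ≥ 1} (1 + w/k)^k exp(w²/(2k) - w)`,
with `γ` Euler's constant. -/
def barnesG (z : ℂ) : ℂ :=
  (2 * Real.pi : ℂ) ^ ((z - 1) / 2) *
    Complex.exp (-((z - 1) + (1 + (Real.eulerMascheroniConstant : ℂ)) * (z - 1) ^ 2) / 2) *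
    ∏' k : ℕ, ((1 + (z - 1) / ((k : ℂ) + 1)) ^ (k + 1) *
      Complex.exp ((z - 1) ^ 2 / (2 * ((k : ℂ) + 1)) - (z - 1)))

/-- The constant `A_{q,b}` for `β / 2 = s / r`. -/
def amplitude (r s : ℕ) (q b : ℂ) : ℂ :=
  (r : ℂ) ^ (-((q ^ 2 - b ^ 2) * ((s : ℂ) / r))) *
    ∏ ν ∈ Finset.range r, ∏ p ∈ Finset.range s,
      (barnesG ((q + b) / r + (ν : ℂ) / r - (p : ℂ) / s + 1) *
          barnesG ((q - b) / r + (ν : ℂ) / r - (p : ℂ) / s + 1)) /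
        (barnesG (2 * q / r + (ν : ℂ) / r - (p : ℂ) / s + 1) *
          barnesG ((ν : ℂ) / r - (p : ℂ) / s + 1))

end CircularBeta

end

namespace CircularBeta

open Complex Topology

/-! ### Asymptotics of the Gamma function -/

/-! With `A = βq` and `D = βb` the average is the quotient of the Morris integrals `morris A D β N`
and `morris 0 0 β N`. It is first computed exactly, then expanded.

Exact value (Aomoto's method): multiplying the weight by `1 + e^{iθ}` moves `(A, D)` to `(A + 1, D +
1)`. Integration by parts in one angle, followed by symmetrisation of the pair interaction, gives a
linear relation each time such a factor is added (`aomoto_insert`). Adding all `N` factors, and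
combining the result with its complex conjugate, gives a recursion `A → A + 2` at fixed `D`
(`morris_add_two`). The Gamma product `morrisProd` obeys the same recursion. The remaining freedom
is removed by large `A`: the weight concentrates at the origin, and both sides have the same
limiting ratio `2^{AN}` (`tendsto_morris_div`, `tendsto_morrisProd_div`). This yields `morris_eq`;
the normalisation `morris 0 0 β N` cancels in the average and is never evaluated.

Asymptotics: for `β/2 = s/r` the index is split as `j = rt + ν`, and Gauss multiplication turns each
cross ratio of Gamma values into `s` cross ratios whose arguments advance by `1` with `t`
(`morrisProd_eq`). Products of `1/Γ(t + 1 + w)` over `t < n` are partial Weierstrass products of the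
Barnes function up to an explicit scale (`prod_inv_gamma_isEquivalent`). In a cross ratio the scales
leave only a power of `n`. -/

/-- The quotient `Γ(n + 1 + w) / (n! n^w)`. -/
noncomputable def gammaQuot (w : ℂ) (n : ℕ) : ℂ :=
  Gamma (n + 1 + w) / (n.factorial * (n : ℂ) ^ w)

theorem tendsto_natCast_add_div (w : ℂ) :
    Tendsto (fun n : ℕ => ((n : ℂ) + w) / n) atTop (𝓝 1) := by
  have h : Tendsto (fun n : ℕ => 1 + w / (n : ℂ)) atTop (𝓝 (1 + 0)) :=
    tendsto_const_nhds.add (tendsto_const_div_atTop_nhds_zero_nat w)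
  rw [add_zero] at h
  refine h.congr' ?_
  filter_upwards [eventually_ne_atTop 0] with n hn
  field_simp

theorem eventually_natCast_add_ne_zero (w : ℂ) : ∀ᶠ n : ℕ in atTop, (n : ℂ) + w ≠ 0 := by
  filter_upwards [(tendsto_natCast_add_div w).eventually_ne one_ne_zero] with n hn h
  simp [h] at hn

theorem tendsto_gammaQuot_of_succ {w : ℂ} (h : Tendsto (gammaQuot (w + 1)) atTop (𝓝 1)) :
    Tendsto (gammaQuot w) atTop (𝓝 1) := by
  have h2 := h.mul ((tendsto_natCast_add_div (1 + w)).inv₀ one_ne_zero)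
  rw [inv_one, mul_one] at h2
  refine h2.congr' ?_
  filter_upwards [eventually_ne_atTop 0, eventually_natCast_add_ne_zero (1 + w)] with n hn hw
  have hn' : (n : ℂ) ≠ 0 := by exact_mod_cast hn
  have hf : (n.factorial : ℂ) ≠ 0 := by exact_mod_cast n.factorial_ne_zero
  have hw' : (n : ℂ) + 1 + w ≠ 0 := by rwa [add_assoc]
  rw [gammaQuot, gammaQuot, ← add_assoc _ w 1, Gamma_add_one _ hw', cpow_add _ _ hn', cpow_one,
    ← add_assoc]
  field_simp

theorem gamma_add_natCast {z : ℂ} (hz : ∀ k : ℕ, z ≠ -k) (n : ℕ) :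
    Gamma (z + n) = Gamma z * ∏ j ∈ Finset.range n, (z + j) := by
  have e : Polynomial.eval z (ascPochhammer ℂ n) = ∏ j ∈ Finset.range n, (z + j) := by
    induction n with
    | zero => simp
    | succ k ih => rw [ascPochhammer_succ_eval, ih, Finset.prod_range_succ]
  rw [← e, ← Gamma_add_nat_div_Gamma_eq z hz, mul_div_cancel₀ _ (Gamma_ne_zero hz)]

/-- Away from the non-positive integers this is Euler's limit for `Γ(w)`, inverted. At `w = -k` that
limit degenerates, and the claim is carried down from `w = 0` by the functional equation. -/
theorem tendsto_gammaQuot (w : ℂ) : Tendsto (gammaQuot w) atTop (𝓝 1) := by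
  by_cases hw : ∀ k : ℕ, w ≠ -k
  · have hG : Gamma w ≠ 0 := Gamma_ne_zero hw
    have h := ((GammaSeq_tendsto_Gamma w).div_const (Gamma w)).inv₀ (by simp [hG])
    rw [div_self hG, inv_one] at h
    refine h.congr' ?_
    filter_upwards [eventually_ne_atTop 0] with n hn
    have e := gamma_add_natCast hw (n + 1)
    push_cast at e
    rw [show w + ((n : ℂ) + 1) = n + 1 + w by ring] at e
    have hP : ∏ j ∈ Finset.range (n + 1), (w + j) ≠ 0 := Finset.prod_ne_zero_iff.2 fun j _ h =>
      hw j (eq_neg_of_add_eq_zero_left h)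
    have hn' : (n : ℂ) ^ w ≠ 0 := by simp [cpow_eq_zero_iff, hn]
    rw [GammaSeq, gammaQuot, e]
    have : (n.factorial : ℂ) ≠ 0 := by exact_mod_cast n.factorial_ne_zero
    field_simp
  · push Not at hw
    obtain ⟨k, rfl⟩ := hw
    induction k with
    | zero =>
      refine tendsto_const_nhds.congr' ?_
      filter_upwards with n
      have : (n.factorial : ℂ) ≠ 0 := by exact_mod_cast n.factorial_ne_zero
      simp [gammaQuot, Gamma_nat_eq_factorial, this]
    | succ k ih =>
      apply tendsto_gammaQuot_of_succ
      convert ih using 2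
      push_cast; ring

/-- The second order remainder of `log (1 + w / (m + 1))`. -/
noncomputable def logRemainder (w : ℂ) (m : ℕ) : ℂ :=
  log (1 + w / (m + 1)) - w / (m + 1) + w ^ 2 / (2 * ((m : ℂ) + 1) ^ 2)

theorem logRemainder_isBigO (w : ℂ) :
    logRemainder w =O[atTop] fun m : ℕ => (((m : ℝ) + 1) ^ 3)⁻¹ := by
  refine IsBigO.of_bound (‖w‖ ^ 3) ?_
  filter_upwards [eventually_ge_atTop ⌈2 * ‖w‖⌉₊] with m hm
  have hm' : 2 * ‖w‖ ≤ m := Nat.ceil_le.1 hm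
  have hpos : (0 : ℝ) < m + 1 := by positivity
  have hn : ‖w / ((m : ℂ) + 1)‖ = ‖w‖ / (m + 1) := by
    rw [norm_div]; congr 1; exact_mod_cast Complex.norm_natCast (m + 1)
  have hz : ‖w / ((m : ℂ) + 1)‖ ≤ 1 / 2 := by
    rw [hn, div_le_iff₀ hpos]; linarith
  have h := norm_log_sub_logTaylor_le 2 (z := w / ((m : ℂ) + 1)) (by linarith)
  have e : logRemainder w m = log (1 + w / (m + 1)) - logTaylor (2 + 1) (w / (m + 1)) := by
    rw [logRemainder]
    simp only [logTaylor, Finset.sum_range_succ, Finset.sum_range_zero]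
    have : (m : ℂ) + 1 ≠ 0 := by exact_mod_cast (Nat.succ_ne_zero m)
    field_simp
    push_cast
    ring
  rw [e]
  refine h.trans ?_
  have h3 : (1 - ‖w / ((m : ℂ) + 1)‖)⁻¹ ≤ 2 := by
    rw [inv_le_comm₀ (by linarith) (by norm_num)]; linarith
  rw [Real.norm_of_nonneg (by positivity), hn] at *
  calc (‖w‖ / (m + 1)) ^ (2 + 1) * (1 - ‖w‖ / (m + 1))⁻¹ / ((2 : ℕ) + 1)
      ≤ (‖w‖ / (m + 1)) ^ (2 + 1) * 2 / ((2 : ℕ) + 1) := by gcongr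
    _ = ‖w‖ ^ 3 * ((m + 1 : ℝ) ^ 3)⁻¹ * (2 / 3) := by push_cast; field_simp; ring
    _ ≤ _ := by
      have : 0 ≤ ‖w‖ ^ 3 * ((m + 1 : ℝ) ^ 3)⁻¹ := by positivity
      linarith

theorem summable_inv_succ_sq : Summable fun m : ℕ => (((m : ℝ) + 1) ^ 2)⁻¹ := by
  have := (summable_nat_add_iff 1).2 (Real.summable_nat_pow_inv.2 (by norm_num : 1 < 2))
  simpa using this

/-- The increment of `log Γ(n + 1 + w) - log n! - w log n - (w² + w) / (2 n)`. -/
noncomputable def gammaIncr (w : ℂ) (m : ℕ) : ℂ :=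
  log (1 + w / (m + 1)) + w * log (1 + (-1) / (m + 1)) +
    (w ^ 2 + w) / 2 * (1 / m - 1 / (m + 1))

/-- The correction `(w² + w)/(2n)` is chosen so that the first and second order terms of the two
logarithms cancel. -/
theorem gammaIncr_isBigO (w : ℂ) :
    gammaIncr w =O[atTop] fun m : ℕ => (((m : ℝ) + 1) ^ 3)⁻¹ := by
  have h3 : (fun m : ℕ => (w ^ 2 + w) / 2 * (1 / ((m : ℂ) * ((m : ℂ) + 1) ^ 2))) =O[atTop]
      fun m : ℕ => (((m : ℝ) + 1) ^ 3)⁻¹ := by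
    refine (IsBigO.of_bound 2 ?_).const_mul_left _
    filter_upwards [eventually_ge_atTop 1] with m hm
    have hm' : (1 : ℝ) ≤ m := by exact_mod_cast hm
    have hn : ‖(m : ℂ) + 1‖ = m + 1 := by exact_mod_cast Complex.norm_natCast (m + 1)
    rw [norm_div, norm_mul, norm_pow, hn, Complex.norm_natCast, norm_one,
      Real.norm_of_nonneg (by positivity), ← div_eq_mul_inv, div_le_div_iff₀ (by positivity)
      (by positivity)]
    have : (m + 1 : ℝ) ≤ 2 * m := by linarith
    calc (1 : ℝ) * (m + 1 : ℝ) ^ 3 = (m + 1) ^ 2 * (m + 1) := by ring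
      _ ≤ (m + 1 : ℝ) ^ 2 * (2 * m) := by gcongr
      _ = _ := by ring
  refine (((logRemainder_isBigO w).add ((logRemainder_isBigO (-1)).const_mul_left w)).add
    h3).congr' ?_ EventuallyEq.rfl
  filter_upwards [eventually_ge_atTop 1] with m hm
  have h0 : (m : ℂ) ≠ 0 := by exact_mod_cast (by omega : m ≠ 0)
  have : (m : ℂ) + 1 ≠ 0 := by exact_mod_cast (Nat.succ_ne_zero m)
  simp only [logRemainder, gammaIncr]
  generalize log (1 + w / ((m : ℂ) + 1)) = x
  generalize log (1 + (-1) / ((m : ℂ) + 1)) = y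
  field_simp
  ring

/-- The extra factor `m + 1` pays for the multiplication of the tail by `n` in
`tendsto_gammaQuot_pow`. -/
theorem summable_mul_gammaIncr (w : ℂ) : Summable fun m : ℕ => ‖((m : ℂ) + 1) * gammaIncr w m‖ := by
  have h : (fun m : ℕ => ((m : ℂ) + 1) * gammaIncr w m) =O[atTop]
      fun m : ℕ => ((m : ℝ) + 1) * (((m : ℝ) + 1) ^ 3)⁻¹ := by
    refine IsBigO.mul (IsBigO.of_bound 1 (Eventually.of_forall fun m => ?_)) (gammaIncr_isBigO w)
    have hn : ‖(m : ℂ) + 1‖ = m + 1 := by exact_mod_cast Complex.norm_natCast (m + 1)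
    rw [hn, Real.norm_of_nonneg (by positivity), one_mul]
  refine (summable_of_isBigO_nat summable_inv_succ_sq (h.congr_right fun m => ?_)).norm
  have : (m : ℝ) + 1 ≠ 0 := by positivity
  field_simp

theorem summable_gammaIncr (w : ℂ) : Summable (gammaIncr w) := by
  refine Summable.of_norm_bounded (summable_mul_gammaIncr w) fun m => ?_
  have hn : ‖(m : ℂ) + 1‖ = m + 1 := by exact_mod_cast Complex.norm_natCast (m + 1)
  rw [norm_mul, hn]
  exact le_mul_of_one_le_left (norm_nonneg _) (by linarith [m.cast_nonneg (α := ℝ)])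

theorem gammaQuot_succ {w : ℂ} {m : ℕ} (hm : m ≠ 0) (hw : (m : ℂ) + 1 + w ≠ 0) :
    gammaQuot w (m + 1) * exp (-((w ^ 2 + w) / 2 / ((m + 1 : ℕ) : ℂ))) =
      gammaQuot w m * exp (-((w ^ 2 + w) / 2 / (m : ℂ))) * exp (gammaIncr w m) := by
  have h0 : (m : ℂ) ≠ 0 := by exact_mod_cast hm
  have h1 : (m : ℂ) + 1 ≠ 0 := by exact_mod_cast (Nat.succ_ne_zero m)
  have hf : (m.factorial : ℂ) ≠ 0 := by exact_mod_cast m.factorial_ne_zero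
  have e1 : exp (log (1 + w / (m + 1))) = (m + 1 + w) / (m + 1) := by
    rw [exp_log]
    · field_simp
    · rw [show 1 + w / ((m : ℂ) + 1) = (m + 1 + w) / (m + 1) by field_simp]
      exact div_ne_zero hw h1
  have e2 : log (1 + (-1) / ((m : ℂ) + 1)) = log m - log (m + 1) := by
    rw [show 1 + (-1) / ((m : ℂ) + 1) = ((m / (m + 1) : ℝ) : ℂ) by push_cast; field_simp; ring,
      ← ofReal_log (by positivity), Real.log_div (by positivity) (by positivity)]
    rw [ofReal_sub, ofReal_log (by positivity), ofReal_log (by positivity)]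
    push_cast; rfl
  have e3 : exp (gammaIncr w m) = (m + 1 + w) / (m + 1) * exp (w * log m) / exp (w * log (m + 1))
      * exp ((w ^ 2 + w) / 2 / m) / exp ((w ^ 2 + w) / 2 / (m + 1)) := by
    rw [gammaIncr, e2, ← e1, ← exp_add, ← exp_sub, ← exp_add, ← exp_sub]
    congr 1; ring
  rw [e3, gammaQuot, gammaQuot, Nat.factorial_succ, cpow_def_of_ne_zero (by exact_mod_cast m.succ_ne_zero),
    cpow_def_of_ne_zero h0, exp_neg, exp_neg]
  push_cast
  rw [show (m : ℂ) + 1 + 1 + w = (m + 1 + w) + 1 by ring, Gamma_add_one _ hw, mul_comm (log _) w,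
    mul_comm (log _) w]
  field_simp

/-- The increments telescope from `n` to infinity, where the quotient tends to `1`. -/
theorem gammaQuot_eq {w : ℂ} {n : ℕ} (hn : n ≠ 0) (hw : ∀ m ≥ n, (m : ℂ) + 1 + w ≠ 0) :
    gammaQuot w n = exp ((w ^ 2 + w) / 2 / n) * exp (-∑' k, gammaIncr w (k + n)) := by
  have key : ∀ K : ℕ, gammaQuot w (K + n) * exp (-((w ^ 2 + w) / 2 / ((K + n : ℕ) : ℂ))) =
      gammaQuot w n * exp (-((w ^ 2 + w) / 2 / n)) *
        exp (∑ k ∈ Finset.range K, gammaIncr w (k + n)) := by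
    intro K
    induction K with
    | zero => simp
    | succ K ih =>
      rw [Finset.sum_range_succ, exp_add, ← mul_assoc, ← ih,
        show K + 1 + n = (K + n) + 1 by ring, gammaQuot_succ (by omega) (hw _ (by omega))]
  have t1 : Tendsto (fun K : ℕ => gammaQuot w (K + n) *
      exp (-((w ^ 2 + w) / 2 / ((K + n : ℕ) : ℂ)))) atTop (𝓝 (1 * exp (-0))) := by
    have h := (tendsto_gammaQuot w).mul
      ((continuous_exp.tendsto _).comp (tendsto_const_div_atTop_nhds_zero_nat ((w ^ 2 + w) / 2)).neg)
    exact h.comp (tendsto_add_atTop_nat n)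
  have t2 : Tendsto (fun K : ℕ => gammaQuot w n * exp (-((w ^ 2 + w) / 2 / n)) *
        exp (∑ k ∈ Finset.range K, gammaIncr w (k + n))) atTop
      (𝓝 (gammaQuot w n * exp (-((w ^ 2 + w) / 2 / n)) * exp (∑' k, gammaIncr w (k + n)))) :=
    tendsto_const_nhds.mul ((continuous_exp.tendsto _).comp
      ((summable_nat_add_iff n).2 (summable_gammaIncr w)).hasSum.tendsto_sum_nat)
  have h := tendsto_nhds_unique t1 (t2.congr fun K => (key K).symm)
  rw [neg_zero, exp_zero, mul_one, exp_neg] at h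
  rw [exp_neg]
  field_simp at h ⊢
  rw [h]

/-- The `n`-th power needs `gammaQuot` to precision `o(1/n)`: the term `(w² + w)/(2n)` survives,
while `n` times the tail is dominated by the tail of the series of `(m + 1) * gammaIncr w m`. -/
theorem tendsto_gammaQuot_pow (w : ℂ) :
    Tendsto (fun n : ℕ => gammaQuot w n ^ n) atTop (𝓝 (exp ((w ^ 2 + w) / 2))) := by
  have hz : Tendsto (fun n : ℕ => (n : ℂ) * ∑' k, gammaIncr w (k + n)) atTop (𝓝 0) := by
    refine squeeze_zero_norm (fun n => ?_)
      (tendsto_sum_nat_add fun m : ℕ => ‖((m : ℂ) + 1) * gammaIncr w m‖)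
    rw [← tsum_mul_left]
    refine tsum_of_norm_bounded ((summable_nat_add_iff n).2 (summable_mul_gammaIncr w)).hasSum
      fun k => ?_
    have hn : ‖((k + n : ℕ) : ℂ) + 1‖ = (k + n : ℕ) + 1 := by
      exact_mod_cast Complex.norm_natCast (k + n + 1)
    rw [norm_mul, norm_mul, hn, Complex.norm_natCast]
    gcongr
    push_cast; linarith [k.cast_nonneg (α := ℝ)]
  have hz2 := (tendsto_const_nhds (x := exp ((w ^ 2 + w) / 2))).mul
    ((continuous_exp.tendsto _).comp hz.neg)
  rw [neg_zero, exp_zero, mul_one] at hz2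
  refine hz2.congr' ?_
  obtain ⟨M, hM⟩ := eventually_atTop.1 (eventually_natCast_add_ne_zero (1 + w))
  filter_upwards [eventually_ge_atTop M, eventually_ne_atTop 0] with n hnM hn
  have hn' : (n : ℂ) ≠ 0 := by exact_mod_cast hn
  rw [gammaQuot_eq hn fun m hm => by rw [add_assoc]; exact hM m (hnM.trans hm), mul_pow,
    ← exp_nat_mul, ← exp_nat_mul]
  simp only [Function.comp]
  congr 2
  · field_simp
  · ring

/-! ### The multiplication formula -/

theorem gamma_natCast_add_eq (w : ℂ) {n : ℕ} (hn : n ≠ 0) :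
    Gamma (n + 1 + w) = gammaQuot w n * (n.factorial * (n : ℂ) ^ w) := by
  have h1 : (n.factorial : ℂ) ≠ 0 := by exact_mod_cast n.factorial_ne_zero
  have h2 : (n : ℂ) ^ w ≠ 0 := by simp [cpow_eq_zero_iff, hn]
  rw [gammaQuot, div_mul_cancel₀ _ (mul_ne_zero h1 h2)]

/-- The product `∏_{k < s} Γ(z + k / s)`. -/
noncomputable def gammaProd (s : ℕ) (z : ℂ) : ℂ := ∏ k ∈ Finset.range s, Gamma (z + k / s)

/-- The quotient of the two sides in the multiplication formula for `Γ`. -/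
noncomputable def gaussQuot (s : ℕ) (z : ℂ) : ℂ :=
  Gamma (s * z) / ((s : ℂ) ^ (s * z) * gammaProd s z)

theorem gaussQuot_add_one {s : ℕ} (hs : 0 < s) {z : ℂ} (hz : ∀ m : ℕ, (s : ℂ) * z ≠ -m) :
    gaussQuot s (z + 1) = gaussQuot s z := by
  have hs' : (s : ℂ) ≠ 0 := by exact_mod_cast hs.ne'
  have hzk (k : ℕ) : z + k / s ≠ 0 := fun h => hz k (by field_simp at h; linear_combination h)
  have e1 : Gamma (s * (z + 1)) = Gamma (s * z) * ((s : ℂ) ^ s * ∏ k ∈ Finset.range s, (z + k / s)) := by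
    rw [mul_add, mul_one, gamma_add_natCast hz]
    congr 1
    rw [← Finset.card_range s, ← Finset.prod_const, Finset.card_range, ← Finset.prod_mul_distrib]
    exact Finset.prod_congr rfl fun k _ => by field_simp
  have e3 : gammaProd s (z + 1) = (∏ k ∈ Finset.range s, (z + k / s)) * gammaProd s z := by
    rw [gammaProd, gammaProd, ← Finset.prod_mul_distrib]
    refine Finset.prod_congr rfl fun k _ => ?_
    rw [← Gamma_add_one _ (hzk k)]
    congr 1; ring
  have h1 : ∏ k ∈ Finset.range s, (z + k / s) ≠ 0 := Finset.prod_ne_zero_iff.2 fun k _ => hzk k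
  have h2 : (s : ℂ) ^ (s : ℕ) ≠ 0 := pow_ne_zero _ hs'
  rw [gaussQuot, gaussQuot, e1, e3, mul_add, mul_one, cpow_add _ _ hs', cpow_natCast]
  have h3 : (s : ℂ) ^ (s * z) ≠ 0 := by simp [cpow_eq_zero_iff, hs']
  generalize ∏ k ∈ Finset.range s, (z + k / s) = p at *
  field_simp

theorem gaussQuot_add_natCast {s : ℕ} (hs : 0 < s) {z : ℂ} (hz : ∀ m : ℕ, (s : ℂ) * z ≠ -m) (n : ℕ) :
    gaussQuot s (z + n) = gaussQuot s z := by
  induction n with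
  | zero => simp
  | succ n ih =>
    rw [Nat.cast_succ, ← add_assoc, gaussQuot_add_one hs, ih]
    intro m hm
    refine hz (m + s * n) ?_
    push_cast
    linear_combination hm

/-- The part of `gaussQuot s (z + n)` which does not depend on `z`. -/
noncomputable def gaussScale (s n : ℕ) : ℂ :=
  (s * n).factorial * ((s : ℂ) * n)⁻¹ / ((s : ℂ) ^ (s * n) *
    ∏ k ∈ Finset.range s, (n.factorial * (n : ℂ) ^ ((k : ℂ) / s - 1)))

/-- By periodicity `z` may be replaced by `z + n`; all dependence on `z` then sits in factors
`gammaQuot` that tend to `1`. -/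
theorem gaussQuot_eq {s n : ℕ} (hs : 0 < s) (hn : n ≠ 0) {z : ℂ}
    (hz : ∀ m : ℕ, (s : ℂ) * z ≠ -m) :
    gaussQuot s z = gammaQuot (s * z - 1) (s * n) /
      (∏ k ∈ Finset.range s, gammaQuot (z + k / s - 1) n) * gaussScale s n := by
  have hs' : (s : ℂ) ≠ 0 := by exact_mod_cast hs.ne'
  have hn' : (n : ℂ) ≠ 0 := by exact_mod_cast hn
  have hsn : s * n ≠ 0 := mul_ne_zero hs.ne' hn
  have e1 : Gamma (s * (z + n)) = gammaQuot (s * z - 1) (s * n) *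
      ((s * n).factorial * (((s : ℂ) ^ (s * z) * (n : ℂ) ^ (s * z)) * ((s : ℂ) * n)⁻¹)) := by
    have := gamma_natCast_add_eq (s * z - 1) hsn
    rw [cpow_sub _ _ (by exact_mod_cast hsn), cpow_one, Nat.cast_mul, natCast_mul_natCast_cpow] at this
    rw [div_eq_mul_inv] at this
    rw [← this]; congr 1; ring
  have e2 : gammaProd s (z + n) = (∏ k ∈ Finset.range s, gammaQuot (z + k / s - 1) n) *
      ((n : ℂ) ^ (s * z) * ∏ k ∈ Finset.range s, (n.factorial * (n : ℂ) ^ ((k : ℂ) / s - 1))) := by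
    have : (n : ℂ) ^ (s * z) = ∏ k ∈ Finset.range s, (n : ℂ) ^ z := by
      rw [Finset.prod_const, Finset.card_range, ← cpow_nat_mul]
    rw [this, ← Finset.prod_mul_distrib, ← Finset.prod_mul_distrib, gammaProd]
    refine Finset.prod_congr rfl fun k _ => ?_
    have h := gamma_natCast_add_eq (z + k / s - 1) hn
    rw [show z + k / s - 1 = z + (k / s - 1) by ring, cpow_add _ _ hn'] at h
    rw [show z + n + k / s = n + 1 + (z + (k / s - 1)) by ring, h,
      show z + k / s - 1 = z + (k / s - 1) by ring]
    ring
  rw [← gaussQuot_add_natCast hs hz n, gaussQuot, e1, e2, gaussScale, mul_add, cpow_add _ _ hs',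
    ← Nat.cast_mul, cpow_natCast]
  have h3 : (s : ℂ) ^ (s * z) ≠ 0 := by simp [cpow_eq_zero_iff, hs']
  have h4 : (n : ℂ) ^ (s * z) ≠ 0 := by simp [cpow_eq_zero_iff, hn']
  simp only [div_eq_mul_inv, mul_inv]
  field_simp

/-- The sequence does not involve `z`, so uniqueness of its limit makes `gaussQuot s` constant away
from the poles. -/
theorem tendsto_gaussScale {s : ℕ} (hs : 0 < s) {z : ℂ} (hz : ∀ m : ℕ, (s : ℂ) * z ≠ -m) :
    Tendsto (gaussScale s) atTop (𝓝 (gaussQuot s z)) := by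
  have t1 : Tendsto (fun n : ℕ => gammaQuot (s * z - 1) (s * n)) atTop (𝓝 1) :=
    (tendsto_gammaQuot _).comp (tendsto_id.const_mul_atTop' hs)
  have t2 : Tendsto (fun n : ℕ => ∏ k ∈ Finset.range s, gammaQuot (z + k / s - 1) n) atTop
      (𝓝 (∏ k ∈ Finset.range s, 1)) :=
    tendsto_finsetProd _ fun k _ => tendsto_gammaQuot _
  rw [Finset.prod_const_one] at t2
  have t3 := t1.div t2 one_ne_zero
  have t4 := (t3.inv₀ (by simp)).const_mul (gaussQuot s z)
  rw [div_one, inv_one, mul_one] at t4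
  refine t4.congr' ?_
  filter_upwards [eventually_ne_atTop 0, t3.eventually_ne (by simp : (1 : ℂ) / 1 ≠ 0)] with n hn h0
  rw [gaussQuot_eq hs hn hz]
  simp only [Pi.div_apply] at h0 ⊢
  rw [mul_assoc, mul_comm, mul_assoc, inv_mul_cancel₀ h0, mul_one]

/-- **Gauss multiplication formula** up to a constant factor. -/
theorem exists_gamma_mul_eq {s : ℕ} (hs : 0 < s) :
    ∃ C : ℂ, C ≠ 0 ∧ ∀ z, Gamma (s * z) = C * (s : ℂ) ^ (s * z) * gammaProd s z := by
  have hs' : (s : ℂ) ≠ 0 := by exact_mod_cast hs.ne'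
  have h3 (z : ℂ) : (s : ℂ) ^ (s * z) ≠ 0 := by simp [cpow_eq_zero_iff, hs']
  have hprod {z : ℂ} (hz : ∀ m : ℕ, (s : ℂ) * z ≠ -m) : gammaProd s z ≠ 0 := by
    refine Finset.prod_ne_zero_iff.2 fun k _ => Gamma_ne_zero fun m h => hz (s * m + k) ?_
    push_cast
    field_simp at h
    linear_combination h
  have h1 : ∀ m : ℕ, (s : ℂ) * 1 ≠ -m := by
    intro m h
    have h' : ((s + m : ℕ) : ℂ) = 0 := by push_cast; linear_combination h
    have : s + m = 0 := by exact_mod_cast h'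
    omega
  refine ⟨gaussQuot s 1, ?_, fun z => ?_⟩
  · exact div_ne_zero (Gamma_ne_zero h1) (mul_ne_zero (h3 1) (hprod h1))
  by_cases hz : ∀ m : ℕ, (s : ℂ) * z ≠ -m
  · rw [tendsto_nhds_unique (tendsto_gaussScale hs h1) (tendsto_gaussScale hs hz), gaussQuot]
    have := hprod hz
    have := h3 z
    field_simp
  -- At a pole `s z = -m` both sides are `0`, since `Gamma` is `0` at its poles; division of `m` by
  -- `s` shows that the factor with index `m % s` is at a pole.
  · push Not at hz
    obtain ⟨m, hm⟩ := hz
    have : gammaProd s z = 0 := by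
      refine Finset.prod_eq_zero (i := m % s) (Finset.mem_range.2 (Nat.mod_lt _ hs)) ?_
      refine (Gamma_eq_zero_iff _).2 ⟨m / s, ?_⟩
      have h : (m : ℂ) = s * (m / s : ℕ) + (m % s : ℕ) := by exact_mod_cast (Nat.div_add_mod m s).symm
      field_simp
      linear_combination hm - h
    rw [hm, Gamma_neg_nat_eq_zero, this, mul_zero]

/-! ### Asymptotics of products of Gamma values -/

/-- The factor with index `k + 1` of the Weierstrass product of `G(1 + w)`. -/
noncomputable def barnesFactor (w : ℂ) (k : ℕ) : ℂ :=
  (1 + w / ((k : ℂ) + 1)) ^ (k + 1) * exp (w ^ 2 / (2 * ((k : ℂ) + 1)) - w)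

theorem summable_mul_logRemainder (w : ℂ) :
    Summable fun k : ℕ => ((k : ℂ) + 1) * logRemainder w k := by
  have h : (fun m : ℕ => ((m : ℂ) + 1) * logRemainder w m) =O[atTop]
      fun m : ℕ => ((m : ℝ) + 1) * (((m : ℝ) + 1) ^ 3)⁻¹ := by
    refine IsBigO.mul (IsBigO.of_bound 1 (Eventually.of_forall fun m => ?_)) (logRemainder_isBigO w)
    have hn : ‖(m : ℂ) + 1‖ = m + 1 := by exact_mod_cast Complex.norm_natCast (m + 1)
    rw [hn, Real.norm_of_nonneg (by positivity), one_mul]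
  refine summable_of_isBigO_nat summable_inv_succ_sq (h.congr_right fun m => ?_)
  have : (m : ℝ) + 1 ≠ 0 := by positivity
  field_simp

/-- `(k + 1) * logRemainder w k` is a logarithm of the `k`-th factor, and it is of order `k⁻²`. -/
theorem hasProd_barnesFactor {w : ℂ} (hw : ∀ k : ℕ, (k : ℂ) + 1 + w ≠ 0) :
    HasProd (barnesFactor w) (exp (∑' k : ℕ, ((k : ℂ) + 1) * logRemainder w k)) := by
  have h := (summable_mul_logRemainder w).hasSum.cexp
  convert h using 1
  funext k
  have h1 : (k : ℂ) + 1 ≠ 0 := by exact_mod_cast (Nat.succ_ne_zero k)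
  have h2 : 1 + w / ((k : ℂ) + 1) ≠ 0 := by
    rw [show 1 + w / ((k : ℂ) + 1) = (k + 1 + w) / (k + 1) by field_simp]
    exact div_ne_zero (hw k) h1
  rw [Function.comp_apply, show ((k : ℂ) + 1) * logRemainder w k =
    ((k + 1 : ℕ) : ℂ) * log (1 + w / (k + 1)) + (w ^ 2 / (2 * ((k : ℂ) + 1)) - w) by
      rw [logRemainder]
      generalize log (1 + w / ((k : ℂ) + 1)) = x
      push_cast
      field_simp
      ring, exp_add, exp_nat_mul, exp_log h2, barnesFactor]

theorem barnesG_add_one (w : ℂ) : barnesG (w + 1) = (2 * Real.pi : ℂ) ^ (w / 2) *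
    exp (-(w + (1 + (Real.eulerMascheroniConstant : ℂ)) * w ^ 2) / 2) * ∏' k, barnesFactor w k := by
  simp only [barnesG, barnesFactor, add_sub_cancel_right]

/-- Each `Γ(t + 1 + w)` is raised to `Γ(n + 1 + w)` by the factors `k + 1 + w` with `t ≤ k < n`;
over all `t` such a factor is used `k + 1` times. -/
theorem prod_gamma_mul_prod_pow {w : ℂ} (hw : ∀ k : ℕ, (k : ℂ) + 1 + w ≠ 0) (n : ℕ) :
    (∏ t ∈ Finset.range n, Gamma (t + 1 + w)) *
      ∏ k ∈ Finset.range n, ((k : ℂ) + 1 + w) ^ (k + 1) = Gamma (n + 1 + w) ^ n := by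
  induction n with
  | zero => simp
  | succ n ih =>
    rw [Finset.prod_range_succ, Finset.prod_range_succ, mul_mul_mul_comm, ih, Nat.cast_succ,
      show (n : ℂ) + 1 + 1 + w = n + 1 + w + 1 by ring, Gamma_add_one _ (hw n),
      mul_pow]
    ring

/-- The elementary growth factor of `∏_{t < n} Γ(t + 1 + w)`. -/
noncomputable def barnesScale (w : ℂ) (n : ℕ) : ℂ :=
  (n.factorial : ℂ) ^ n / (∏ k ∈ Finset.range n, ((k : ℂ) + 1) ^ (k + 1)) *
    exp (w * (n * log n - n + log (2 * Real.pi) / 2) + w ^ 2 / 2 * log n)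

theorem barnesScale_ne_zero (w : ℂ) (n : ℕ) : barnesScale w n ≠ 0 := by
  refine mul_ne_zero (div_ne_zero (pow_ne_zero _ (by exact_mod_cast n.factorial_ne_zero))
    (Finset.prod_ne_zero_iff.2 fun k _ => pow_ne_zero _ (by exact_mod_cast k.succ_ne_zero)))
    (exp_ne_zero _)

/-- The harmonic number collects the terms `w²/(2k)` of the convergence factors; minus `log n` it
will produce Euler's constant. -/
theorem prod_pow_eq (w : ℂ) (n : ℕ) :
    ∏ k ∈ Finset.range n, ((k : ℂ) + 1 + w) ^ (k + 1) =
      (∏ k ∈ Finset.range n, ((k : ℂ) + 1) ^ (k + 1)) * (∏ k ∈ Finset.range n, barnesFactor w k) *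
        exp (n * w - w ^ 2 / 2 * (harmonic n : ℚ)) := by
  induction n with
  | zero => simp
  | succ n ih =>
    have h1 : (n : ℂ) + 1 ≠ 0 := by exact_mod_cast (Nat.succ_ne_zero n)
    rw [Finset.prod_range_succ, Finset.prod_range_succ, Finset.prod_range_succ, ih, harmonic_succ]
    have e : ((n : ℂ) + 1 + w) ^ (n + 1) = ((n : ℂ) + 1) ^ (n + 1) * (1 + w / (n + 1)) ^ (n + 1) := by
      rw [← mul_pow]; congr 1; field_simp
    have e2 : exp (((n + 1 : ℕ) : ℂ) * w - w ^ 2 / 2 * ((harmonic n + ((n + 1 : ℕ) : ℚ)⁻¹ : ℚ) : ℂ)) =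
        exp (n * w - w ^ 2 / 2 * (harmonic n : ℚ)) *
          (exp (w ^ 2 / (2 * ((n : ℂ) + 1)) - w))⁻¹ := by
      rw [← exp_neg, ← exp_add]
      congr 1
      push_cast
      field_simp
      ring
    rw [e2, e, barnesFactor]
    have := exp_ne_zero (w ^ 2 / (2 * ((n : ℂ) + 1)) - w)
    field_simp

theorem prod_inv_gamma_mul_barnesScale {w : ℂ} (hw : ∀ k : ℕ, (k : ℂ) + 1 + w ≠ 0) {n : ℕ}
    (hn : n ≠ 0) :
    (∏ t ∈ Finset.range n, (Gamma (t + 1 + w))⁻¹) * barnesScale w n =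
      (gammaQuot w n ^ n)⁻¹ * exp (w * (log (2 * Real.pi) / 2) -
        w ^ 2 / 2 * ((harmonic n : ℚ) - log n)) * ∏ k ∈ Finset.range n, barnesFactor w k := by
  have hn' : (n : ℂ) ≠ 0 := by exact_mod_cast hn
  have hf : (n.factorial : ℂ) ≠ 0 := by exact_mod_cast n.factorial_ne_zero
  have hH : ∏ k ∈ Finset.range n, ((k : ℂ) + 1) ^ (k + 1) ≠ 0 :=
    Finset.prod_ne_zero_iff.2 fun k _ => pow_ne_zero _ (by exact_mod_cast k.succ_ne_zero)
  have hG : ∏ t ∈ Finset.range n, Gamma (t + 1 + w) ≠ 0 := by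
    refine Finset.prod_ne_zero_iff.2 fun t _ => Gamma_ne_zero fun m h => hw (t + m) ?_
    push_cast; linear_combination h
  have hQ : gammaQuot w n ≠ 0 := by
    refine div_ne_zero (Gamma_ne_zero fun m h => hw (n + m) ?_) (mul_ne_zero hf ?_)
    · push_cast; linear_combination h
    · simp [cpow_eq_zero_iff, hn']
  have h := prod_gamma_mul_prod_pow hw n
  rw [prod_pow_eq, gamma_natCast_add_eq w hn, mul_pow, mul_pow, ← cpow_nat_mul,
    cpow_def_of_ne_zero hn'] at h
  have e : exp (w * (n * log n - n + log (2 * Real.pi) / 2) + w ^ 2 / 2 * log n) =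
      exp (log n * (n * w)) * exp (w * (log (2 * Real.pi) / 2) -
        w ^ 2 / 2 * ((harmonic n : ℚ) - log n)) * (exp (n * w - w ^ 2 / 2 * (harmonic n : ℚ)))⁻¹ := by
    rw [← exp_neg, ← exp_add, ← exp_add]; congr 1; ring
  have hE := exp_ne_zero (n * w - w ^ 2 / 2 * (harmonic n : ℚ))
  rw [barnesScale, e, Finset.prod_inv_distrib]
  generalize exp (n * w - w ^ 2 / 2 * (harmonic n : ℚ)) = E at *
  generalize exp (w * (log (2 * Real.pi) / 2) - w ^ 2 / 2 * ((harmonic n : ℚ) - log n)) = E' at *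
  generalize exp (log n * (n * w)) = E'' at *
  field_simp
  linear_combination -E' * h

theorem prod_inv_gamma_isEquivalent (w : ℂ) :
    (fun n : ℕ => ∏ t ∈ Finset.range n, (Gamma (t + 1 + w))⁻¹) ~[atTop]
      fun n => barnesG (w + 1) * (barnesScale w n)⁻¹ := by
  by_cases hw : ∀ k : ℕ, (k : ℂ) + 1 + w ≠ 0
  · have hp := hasProd_barnesFactor hw
    have hG : barnesG (w + 1) ≠ 0 := by
      rw [barnesG_add_one, hp.tprod_eq]
      have : (2 * Real.pi : ℂ) ≠ 0 := by exact_mod_cast Real.two_pi_pos.ne'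
      refine mul_ne_zero (mul_ne_zero ?_ (exp_ne_zero _)) (exp_ne_zero _)
      rw [cpow_def_of_ne_zero this]; exact exp_ne_zero _
    have hlim : Tendsto (fun n : ℕ => (gammaQuot w n ^ n)⁻¹ *
        exp (w * (log (2 * Real.pi) / 2) - w ^ 2 / 2 * ((harmonic n : ℚ) - log n)) *
          ∏ k ∈ Finset.range n, barnesFactor w k) atTop (𝓝 (barnesG (w + 1))) := by
      have t1 := (tendsto_gammaQuot_pow w).inv₀ (exp_ne_zero _)
      have t2 : Tendsto (fun n : ℕ => (((harmonic n : ℚ) : ℂ) - log n)) atTop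
          (𝓝 (Real.eulerMascheroniConstant : ℂ)) := by
        refine ((continuous_ofReal.tendsto _).comp Real.tendsto_harmonic_sub_log).congr fun n => ?_
        simp only [Function.comp]
        push_cast
        rw [← natCast_log]
      have t3 := (continuous_exp.tendsto _).comp
        ((tendsto_const_nhds (x := w * (log (2 * Real.pi) / 2))).sub
          (t2.const_mul (w ^ 2 / 2)))
      convert (t1.mul t3).mul hp.tendsto_prod_nat using 1
      congr 1
      rw [barnesG_add_one, hp.tprod_eq,
        cpow_def_of_ne_zero (by exact_mod_cast Real.two_pi_pos.ne'), ← exp_neg, ← exp_add, ← exp_add, ← exp_add,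
        ← exp_add]
      congr 2
      ring
    refine isEquivalent_of_tendsto_one ?_
    have h2 := hlim.div_const (barnesG (w + 1))
    rw [div_self hG] at h2
    refine h2.congr' ?_
    filter_upwards [eventually_ne_atTop 0] with n hn
    rw [← prod_inv_gamma_mul_barnesScale hw hn]
    have := barnesScale_ne_zero w n
    simp only [Pi.div_apply]
    field_simp
  -- Here `w + 1 = -k` is a zero of `G`. A factor `(Gamma 0)⁻¹ = 0` enters once `n > k`, so both
  -- sides are eventually `0`.
  · push Not at hw
    obtain ⟨k, hk⟩ := hw
    have hG : barnesG (w + 1) = 0 := by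
      have h1 : (k : ℂ) + 1 ≠ 0 := by exact_mod_cast (Nat.succ_ne_zero k)
      have : HasProd (barnesFactor w) 0 := by
        refine hasProd_zero_of_exists_eq_zero ⟨k, ?_⟩
        rw [barnesFactor, show 1 + w / ((k : ℂ) + 1) = (k + 1 + w) / (k + 1) by field_simp, hk]
        simp
      rw [barnesG_add_one, this.tprod_eq, mul_zero]
    refine (IsEquivalent.refl (u := fun _ : ℕ => (0 : ℂ))).congr_left ?_ |>.trans ?_
    · filter_upwards [eventually_gt_atTop k] with n hn
      rw [Finset.prod_eq_zero (Finset.mem_range.2 hn)]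
      rw [hk, Gamma_zero, inv_zero]
    · simp only [hG, zero_mul]
      exact IsEquivalent.refl

/-! ### The weight on the circle -/

/-- The point `e^{i t}` of the unit circle. -/
noncomputable def circ (t : ℝ) : ℂ := exp (I * t)

/-- The distance between two points of the unit circle at angular distance `u`. -/
noncomputable def chord (u : ℝ) : ℝ := |2 * Real.sin (u / 2)|

/-- The uniform measure on `(-π, π]`, of total mass `2π`. -/
noncomputable def arcMeasure : Measure ℝ := volume.restrict (Set.Ioc (-Real.pi) Real.pi)

/-- The symbol `e^{i D t / 2} |1 + e^{i t}|^A`. -/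
noncomputable def weight (A D : ℂ) (t : ℝ) : ℂ :=
  exp (I * D * t / 2) * ((‖1 + circ t‖ : ℝ) : ℂ) ^ A

theorem symbol_eq_weight (β : ℝ) (q b : ℂ) : symbol β q b = weight (β * q) (β * b) := by
  funext t
  simp only [symbol, weight, circ, mul_assoc]

theorem circ_add (a b : ℝ) : circ (a + b) = circ a * circ b := by
  simp only [circ, ofReal_add, mul_add, exp_add]

theorem norm_circ (t : ℝ) : ‖circ t‖ = 1 := by
  rw [circ, mul_comm]; exact norm_exp_ofReal_mul_I t

theorem circ_ne_zero (t : ℝ) : circ t ≠ 0 := exp_ne_zero _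

theorem continuous_circ : Continuous circ := by unfold circ; fun_prop

theorem continuous_chord : Continuous chord := by unfold chord; fun_prop

theorem chord_nonneg (u : ℝ) : 0 ≤ chord u := abs_nonneg _

theorem chord_le_two (u : ℝ) : chord u ≤ 2 := by
  rw [chord, abs_mul, abs_two]
  linarith [Real.abs_sin_le_one (u / 2)]

theorem chord_neg (u : ℝ) : chord (-u) = chord u := by
  simp [chord, neg_div]

theorem chord_periodic : Function.Periodic chord (2 * Real.pi) := by
  intro u
  rw [chord, chord, show (u + 2 * Real.pi) / 2 = u / 2 + Real.pi by ring, Real.sin_add_pi]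
  simp

theorem norm_circ_sub_circ (a b : ℝ) : ‖circ a - circ b‖ = chord (a - b) := by
  have : circ a - circ b = circ b * (circ (a - b) - 1) := by
    rw [mul_sub, ← circ_add]; simp
  rw [this, norm_mul, norm_circ, one_mul, circ, norm_exp_I_mul_ofReal_sub_one, chord, Real.norm_eq_abs]

theorem norm_one_add_circ (t : ℝ) : ‖1 + circ t‖ = chord (t + Real.pi) := by
  have h : circ Real.pi = -1 := by rw [circ, mul_comm, exp_pi_mul_I]
  have : ‖1 + circ t‖ = ‖circ t - circ Real.pi‖ := by rw [h]; congr 1; ring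
  rw [this, norm_circ_sub_circ, ← chord_periodic]
  congr 1; ring

theorem one_add_circ (t : ℝ) : 1 + circ t = exp (I * t / 2) * (2 * Real.cos (t / 2) : ℝ) := by
  push_cast
  rw [circ, Complex.cos, mul_div_cancel₀ _ two_ne_zero, mul_add, ← exp_add, ← exp_add,
    show I * (t : ℂ) / 2 + (t / 2 * I) = I * t by ring,
    show I * (t : ℂ) / 2 + (-(t / 2) * I) = 0 by ring, exp_zero, add_comm]

theorem norm_one_add_circ_of_mem {t : ℝ} (ht : t ∈ Set.Icc (-Real.pi) Real.pi) :
    ‖1 + circ t‖ = 2 * Real.cos (t / 2) := by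
  have h : 0 ≤ Real.cos (t / 2) :=
    Real.cos_nonneg_of_neg_pi_div_two_le_of_le (by linarith [ht.1]) (by linarith [ht.2])
  rw [norm_one_add_circ, chord, show (t + Real.pi) / 2 = t / 2 + Real.pi / 2 by ring,
    Real.sin_add_pi_div_two, abs_of_nonneg (by linarith)]

theorem norm_one_add_circ_le (t : ℝ) : ‖1 + circ t‖ ≤ 2 := by
  rw [norm_one_add_circ]; exact chord_le_two _

/-- For `c < 0` Jordan's inequality bounds the chord below by `2u/π` on `(0, π]`; reflection and
periodicity give every other interval. -/
theorem intervalIntegrable_chord_rpow {c : ℝ} (hc : -1 < c) (a b : ℝ) :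
    IntervalIntegrable (fun u => chord u ^ c) volume a b := by
  have hmeas : Measurable fun u => chord u ^ c := continuous_chord.measurable.pow_const c
  have h1 : IntervalIntegrable (fun u => chord u ^ c) volume 0 Real.pi := by
    rcases le_or_gt 0 c with h | h
    · exact (continuous_chord.rpow_const fun _ => Or.inr h).intervalIntegrable _ _
    · refine IntervalIntegrable.mono_fun
        ((intervalIntegral.intervalIntegrable_rpow' hc).const_mul ((2 / Real.pi) ^ c))
        hmeas.aestronglyMeasurable ?_
      rw [Set.uIoc_of_le Real.pi_pos.le]
      filter_upwards [ae_restrict_mem measurableSet_Ioc] with u hu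
      have hpos : 0 < 2 / Real.pi * u := mul_pos (by positivity) hu.1
      have hle : 2 / Real.pi * u ≤ chord u := by
        have := Real.mul_le_sin (x := u / 2) (by linarith [hu.1]) (by linarith [hu.2])
        refine le_trans ?_ (le_abs_self _)
        calc 2 / Real.pi * u = 2 * (2 / Real.pi * (u / 2)) := by ring
          _ ≤ _ := by gcongr
      rw [Real.norm_of_nonneg (Real.rpow_nonneg (chord_nonneg u) c),
        ← Real.mul_rpow (by positivity) hu.1.le, Real.norm_of_nonneg (by positivity)]
      exact Real.rpow_le_rpow_of_nonpos hpos hle h.le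
  have h2 : IntervalIntegrable (fun u => chord u ^ c) volume (-Real.pi) 0 := by
    have := h1.comp_sub_left 0
    simp only [zero_sub, chord_neg, sub_zero] at this
    exact this.symm
  refine Function.Periodic.intervalIntegrable (T := 2 * Real.pi) (t := -Real.pi) ?_
    Real.two_pi_pos.ne' ?_ a b
  · intro u; simp only [chord_periodic u]
  · rw [show -Real.pi + 2 * Real.pi = Real.pi by ring]
    exact h2.trans h1

theorem neg_pi_le_pi : -Real.pi ≤ Real.pi := by linarith [Real.pi_pos]

theorem integrable_chord_sub_rpow {c : ℝ} (hc : -1 < c) (φ : ℝ) :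
    Integrable (fun t => chord (φ - t) ^ c) arcMeasure := by
  have h := (intervalIntegrable_chord_rpow hc (φ + Real.pi) (φ - Real.pi)).comp_sub_left φ
  rw [show φ - (φ + Real.pi) = -Real.pi by ring, show φ - (φ - Real.pi) = Real.pi by ring] at h
  exact (intervalIntegrable_iff_integrableOn_Ioc_of_le neg_pi_le_pi).1 h

theorem integral_chord_sub_rpow (c φ : ℝ) :
    ∫ t, chord (φ - t) ^ c ∂arcMeasure = ∫ t, chord t ^ c ∂arcMeasure := by
  rw [arcMeasure, ← intervalIntegral.integral_of_le neg_pi_le_pi,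
    ← intervalIntegral.integral_of_le neg_pi_le_pi]
  have hp : Function.Periodic (fun u => chord u ^ c) (2 * Real.pi) := fun u => by
    simp only [chord_periodic u]
  rw [intervalIntegral.integral_comp_sub_left (fun u => chord u ^ c) φ]
  have h := hp.intervalIntegral_add_eq (φ - Real.pi) (-Real.pi)
  rw [show φ - Real.pi + 2 * Real.pi = φ - -Real.pi by ring,
    show -Real.pi + 2 * Real.pi = Real.pi by ring] at h
  exact h

theorem measurable_weight (A D : ℂ) : Measurable (weight A D) := by
  unfold weight circ
  fun_prop

theorem norm_ofReal_cpow_le {x : ℝ} (hx : 0 ≤ x) (A : ℂ) : ‖(x : ℂ) ^ A‖ ≤ x ^ A.re := by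
  rcases hx.eq_or_lt with rfl | h
  · by_cases hA : A = 0
    · simp [hA]
    · rw [ofReal_zero, zero_cpow hA, norm_zero]
      exact Real.rpow_nonneg le_rfl _
  · rw [norm_cpow_eq_rpow_re_of_pos h]

theorem norm_exp_le_of_mem (D : ℂ) {t : ℝ} (ht : t ∈ Set.Ioc (-Real.pi) Real.pi) :
    ‖exp (I * D * t / 2)‖ ≤ Real.exp (‖D‖ * Real.pi / 2) := by
  rw [norm_exp]
  refine Real.exp_le_exp.2 ((re_le_norm _).trans ?_)
  rw [norm_div, norm_mul, norm_mul, norm_I, one_mul, norm_real, Real.norm_eq_abs, norm_ofNat]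
  gcongr
  exact abs_le.2 ⟨ht.1.le, ht.2⟩

theorem norm_weight_le (A D : ℂ) {t : ℝ} (ht : t ∈ Set.Ioc (-Real.pi) Real.pi) :
    ‖weight A D t‖ ≤ Real.exp (‖D‖ * Real.pi / 2) * ‖1 + circ t‖ ^ A.re := by
  rw [weight, norm_mul]
  gcongr
  · exact norm_exp_le_of_mem D ht
  · exact norm_ofReal_cpow_le (norm_nonneg _) A

theorem integrable_weight {A : ℂ} (hA : -1 < A.re) (D : ℂ) :
    Integrable (weight A D) arcMeasure := by
  have h : Integrable (fun t => Real.exp (‖D‖ * Real.pi / 2) * ‖1 + circ t‖ ^ A.re) arcMeasure := by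
    refine Integrable.const_mul ((integrable_chord_sub_rpow hA (-Real.pi)).congr ?_) _
    refine Eventually.of_forall fun t => ?_
    simp only [norm_one_add_circ]
    rw [← chord_neg]
    congr 2; ring
  refine h.mono' (measurable_weight A D).aestronglyMeasurable ?_
  exact (ae_restrict_mem measurableSet_Ioc).mono fun t ht => norm_weight_le A D ht

/-- On this interval `1 + e^{it} = e^{it/2} |1 + e^{it}|`, so both parameters rise by one. The bound
on `A` makes `A + 1 ≠ 0`, which settles the endpoints. -/
theorem one_add_circ_mul_weight {A : ℂ} (hA : -1 < A.re) (D : ℂ) {t : ℝ}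
    (ht : t ∈ Set.Icc (-Real.pi) Real.pi) :
    (1 + circ t) * weight A D t = weight (A + 1) (D + 1) t := by
  have h1 : A + 1 ≠ 0 := fun h => by
    have := congrArg re h
    simp at this
    linarith
  have e : exp (I * (D + 1) * t / 2) = exp (I * t / 2) * exp (I * D * t / 2) := by
    rw [← exp_add]; congr 1; ring
  rw [weight, weight, e]
  nth_rw 1 [one_add_circ]
  rw [← norm_one_add_circ_of_mem ht]
  by_cases h0 : ((‖1 + circ t‖ : ℝ) : ℂ) = 0
  · rw [h0, zero_cpow h1]; simp
  · rw [cpow_add _ _ h0, cpow_one]; ring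

theorem continuous_weight {A : ℂ} (hA : 0 < A.re) (D : ℂ) : Continuous (weight A D) := by
  unfold weight
  exact (by fun_prop : Continuous fun t : ℝ => exp (I * D * t / 2)).mul
    ((continuous_ofReal_cpow_const hA).comp (continuous_const.add continuous_circ).norm)

/-- Differentiating the raised weight returns the original one times a polynomial of degree one in
`e^{it}`; this is why the recursion closes. -/
theorem hasDerivAt_weight (A D : ℂ) {t : ℝ}
    (ht : t ∈ Set.Ioo (-Real.pi) Real.pi) :
    HasDerivAt (weight (A + 1) (D + 1))
      (I * (((A + D) / 2 + 1) * circ t - (A - D) / 2) * weight A D t) t := by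
  have hcos : 0 < Real.cos (t / 2) :=
    Real.cos_pos_of_mem_Ioo ⟨by linarith [ht.1], by linarith [ht.2]⟩
  have h1 : HasDerivAt (fun u : ℝ => ((2 * Real.cos (u / 2) : ℝ) : ℂ)) ((-Real.sin (t / 2) : ℝ) : ℂ) t := by
    refine HasDerivAt.ofReal_comp ?_
    have := ((Real.hasDerivAt_cos (t / 2)).comp t ((hasDerivAt_id t).div_const 2)).const_mul 2
    refine this.congr_deriv ?_
    ring
  have h2 : HasDerivAt (fun u : ℝ => exp (I * (D + 1) * u / 2))
      (exp (I * (D + 1) * t / 2) * (I * (D + 1) * 1 / 2)) t :=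
    (((hasDerivAt_id t).ofReal_comp.const_mul (I * (D + 1))).div_const 2).cexp
  have h3 : HasDerivAt (fun u : ℝ => ((2 * Real.cos (u / 2) : ℝ) : ℂ) ^ (A + 1))
      ((A + 1) * ((2 * Real.cos (t / 2) : ℝ) : ℂ) ^ (A + 1 - 1) * ((-Real.sin (t / 2) : ℝ) : ℂ)) t := by
    have hs : ((2 * Real.cos (t / 2) : ℝ) : ℂ) ∈ slitPlane :=
      ofReal_mem_slitPlane.2 (by linarith)
    exact (hasStrictDerivAt_cpow_const hs).hasDerivAt.comp t h1
  have h4 := h2.mul h3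
  have hev : weight (A + 1) (D + 1) =ᶠ[𝓝 t] fun u : ℝ => exp (I * (D + 1) * u / 2) *
      ((2 * Real.cos (u / 2) : ℝ) : ℂ) ^ (A + 1) := by
    filter_upwards [isOpen_Ioo.mem_nhds ht] with u hu
    rw [weight, norm_one_add_circ_of_mem (Set.Ioo_subset_Icc_self hu)]
  refine (h4.congr_of_eventuallyEq hev).congr_deriv ?_
  have hne : ((2 * Real.cos (t / 2) : ℝ) : ℂ) ≠ 0 := ofReal_ne_zero.2 (by linarith)
  rw [weight, norm_one_add_circ_of_mem (Set.Ioo_subset_Icc_self ht), add_sub_cancel_right,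
    cpow_add _ _ hne, cpow_one, show I * (D + 1) * (t : ℂ) / 2 = I * t / 2 + I * D * t / 2 by ring, exp_add]
  generalize ((2 * Real.cos (t / 2) : ℝ) : ℂ) ^ A = p
  have ec : circ t = exp (I * t / 2) * exp (I * t / 2) := by
    rw [← exp_add, circ]; congr 1; ring
  have e1 : exp (I * t / 2) * exp (-(I * t / 2)) = 1 := by rw [← exp_add]; simp
  push_cast
  rw [ec, Complex.cos, Complex.sin, show (t : ℂ) / 2 * I = I * t / 2 by ring,
    show -((t : ℂ) / 2) * I = -(I * t / 2) by ring]
  generalize exp (I * t / 2) = E at *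
  generalize exp (-(I * t / 2)) = E' at *
  generalize exp (I * D * t / 2) = F
  linear_combination (-(I * (A - D) / 2 * F * p)) * e1

/-- The kernel `(x + x') / (x - x')` at the points `x = e^{i t}`, `x' = e^{i φ}`. -/
noncomputable def cotKernel (t φ : ℝ) : ℂ := (circ t + circ φ) / (circ t - circ φ)

theorem cotKernel_swap (t φ : ℝ) : cotKernel φ t = -cotKernel t φ := by
  rw [cotKernel, cotKernel, ← neg_sub (circ t), div_neg, add_comm]

/-- Writing the chord power as `(4 sin²)^{β/2}` removes the absolute value. The logarithmic
derivative is `(β/2) cot((t - φ)/2)`, and the cotangent is `I * cotKernel t φ`. -/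
theorem hasDerivAt_chord_rpow (β : ℝ) {t φ : ℝ} (h : circ t ≠ circ φ) :
    HasDerivAt (fun u : ℝ => ((chord (φ - u) ^ β : ℝ) : ℂ))
      (I * (β / 2) * cotKernel t φ * ((chord (φ - t) ^ β : ℝ) : ℂ)) t := by
  have e (u : ℝ) : chord (φ - u) ^ β = ((2 * Real.sin ((u - φ) / 2)) ^ 2) ^ (β / 2) := by
    rw [chord, ← sq_abs (2 * Real.sin ((u - φ) / 2)), ← Real.rpow_natCast, ← Real.rpow_mul (abs_nonneg _),
      show (φ - u) / 2 = -((u - φ) / 2) by ring, Real.sin_neg, mul_neg, abs_neg]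
    congr 1; push_cast; ring
  have hs : Real.sin ((t - φ) / 2) ≠ 0 := by
    intro hs
    apply h
    rw [← sub_eq_zero, ← norm_eq_zero, norm_circ_sub_circ, chord, hs]; simp
  have hd : HasDerivAt (fun u : ℝ => (2 * Real.sin ((u - φ) / 2)) ^ 2)
      (2 * (2 * Real.sin ((t - φ) / 2)) * (Real.cos ((t - φ) / 2))) t := by
    have h1 := (((Real.hasDerivAt_sin ((t - φ) / 2)).comp t
      (((hasDerivAt_id t).sub_const φ).div_const 2)).const_mul 2).pow 2
    refine h1.congr_deriv ?_
    simp only [Function.comp, id]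
    push_cast
    ring
  have hpos : 0 < (2 * Real.sin ((t - φ) / 2)) ^ 2 := by positivity
  have h2 := (hd.rpow_const (p := β / 2) (Or.inl hpos.ne')).ofReal_comp
  simp only [e]
  refine h2.congr_deriv ?_
  rw [Real.rpow_sub_one hpos.ne']
  have ek : I * cotKernel t φ = (Real.cos ((t - φ) / 2) / Real.sin ((t - φ) / 2) : ℝ) := by
    have hsub : circ t - circ φ ≠ 0 := sub_ne_zero.2 h
    have hs' : (Real.sin ((t - φ) / 2) : ℂ) ≠ 0 := ofReal_ne_zero.2 hs
    have et : circ t = circ ((t + φ) / 2) * circ ((t - φ) / 2) := by rw [← circ_add]; congr 1; ring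
    have ef : circ φ = circ ((t + φ) / 2) * circ (-((t - φ) / 2)) := by rw [← circ_add]; congr 1; ring
    have ea (x : ℝ) : circ x + circ (-x) = 2 * Real.cos x := by
      rw [circ, circ, ofReal_cos, Complex.cos]; push_cast; rw [mul_comm I, mul_comm I]; ring
    have eb (x : ℝ) : circ x - circ (-x) = 2 * I * Real.sin x := by
      rw [circ, circ, ofReal_sin, Complex.sin]; push_cast; rw [mul_comm I, mul_comm I]
      linear_combination (cexp (x * I) - cexp (-(x : ℂ) * I)) * I_sq
    rw [cotKernel, et, ef, ← mul_add, ← mul_sub, mul_div_mul_left _ _ (circ_ne_zero _), ea, eb]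
    push_cast at hs' ⊢
    field_simp
  rw [show I * (β / 2) * cotKernel t φ = (β / 2) * (I * cotKernel t φ) by ring, ek]
  rw [← ofReal_ofNat, ← ofReal_div, ← ofReal_mul, ← ofReal_mul]
  congr 1
  field_simp

theorem countable_circ_eq (φ : ℝ) : {t : ℝ | circ t = circ φ}.Countable := by
  refine (Set.countable_range fun n : ℤ => φ + n * (2 * Real.pi)).mono fun t ht => ?_
  obtain ⟨n, hn⟩ := exp_eq_exp_iff_exists_int.1 ht
  refine ⟨n, ?_⟩
  have : (t : ℂ) = ((φ + n * (2 * Real.pi) : ℝ) : ℂ) := by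
    push_cast
    refine mul_left_cancel₀ I_ne_zero ?_
    linear_combination hn
  exact_mod_cast this.symm

/-- Integration by parts on the circle. -/
theorem integral_deriv_weight_mul_prod {A : ℂ} (hA : -1 < A.re) (D : ℂ) {β : ℝ} (hβ : 0 < β)
    {ι : Type*} [DecidableEq ι] (T : Finset ι) (φ : ι → ℝ) :
    ∫ t, ((((A + D) / 2 + 1) * circ t - (A - D) / 2) +
        (1 + circ t) * ((β / 2) * ∑ k ∈ T, cotKernel t (φ k))) * weight A D t *
      ∏ k ∈ T, ((chord (φ k - t) ^ β : ℝ) : ℂ) ∂arcMeasure = 0 := by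
  set F : ℝ → ℂ := fun t => ((((A + D) / 2 + 1) * circ t - (A - D) / 2) +
        (1 + circ t) * ((β / 2) * ∑ k ∈ T, cotKernel t (φ k))) * weight A D t *
      ∏ k ∈ T, ((chord (φ k - t) ^ β : ℝ) : ℂ) with hF
  -- Without integrability the Bochner integral is `0` by definition.
  by_cases hint : Integrable F arcMeasure
  swap
  · exact integral_undef hint
  have hA1 : 0 < (A + 1).re := by simp; linarith
  have hfin := integral_eq_of_hasDerivAt_off_countable_of_le (a := -Real.pi) (b := Real.pi)
    (fun t => weight (A + 1) (D + 1) t * ∏ k ∈ T, ((chord (φ k - t) ^ β : ℝ) : ℂ))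
    (fun t => I * F t) neg_pi_le_pi
    -- At collisions with some `φ k` differentiability may fail; continuity there suffices, as the
    -- set is countable.
    (s := ⋃ k ∈ T, {t : ℝ | circ t = circ (φ k)})
    (T.countable_toSet.biUnion fun k _ => countable_circ_eq (φ k)) ?_ ?_ ?_
  -- The boundary terms at `±π` vanish because `A + 1` has positive real part.
  · have hend (t : ℝ) (h : 1 + circ t = 0) : weight (A + 1) (D + 1) t = 0 := by
      rw [weight, h, norm_zero, ofReal_zero, zero_cpow, mul_zero]
      intro h; rw [h] at hA1; simp at hA1
    rw [hend Real.pi, hend (-Real.pi), zero_mul, zero_mul, sub_zero,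
      intervalIntegral.integral_const_mul, intervalIntegral.integral_of_le neg_pi_le_pi] at hfin
    · exact (mul_eq_zero.1 hfin).resolve_left I_ne_zero
    · rw [circ, ofReal_neg, mul_neg, exp_neg, mul_comm, exp_pi_mul_I]; norm_num
    · rw [circ, mul_comm, exp_pi_mul_I]; norm_num
  · refine ((continuous_weight hA1 _).mul (continuous_finsetProd _ fun k _ => ?_)).continuousOn
    exact continuous_ofReal.comp ((continuous_chord.comp (continuous_const.sub continuous_id)).rpow_const
      fun _ => Or.inr hβ.le)
  · rintro t ⟨ht, hne⟩
    simp only [Set.mem_iUnion, not_exists, Set.mem_ofPred_eq] at hne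
    have hp := HasDerivAt.fun_finsetProd (u := T) fun k hk => hasDerivAt_chord_rpow β (hne k hk)
    refine ((hasDerivAt_weight A D ht).mul hp).congr_deriv ?_
    have hs : ∑ k ∈ T, (∏ j ∈ T.erase k, ((chord (φ j - t) ^ β : ℝ) : ℂ)) •
        (I * (β / 2) * cotKernel t (φ k) * ((chord (φ k - t) ^ β : ℝ) : ℂ)) =
        (I * ((β / 2) * ∑ k ∈ T, cotKernel t (φ k))) * ∏ k ∈ T, ((chord (φ k - t) ^ β : ℝ) : ℂ) := by
      rw [Finset.mul_sum, Finset.mul_sum, Finset.sum_mul]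
      refine Finset.sum_congr rfl fun k hk => ?_
      rw [← Finset.mul_prod_erase T _ hk, smul_eq_mul]
      ring
    rw [hs, hF, ← one_add_circ_mul_weight hA D (Set.Ioo_subset_Icc_self ht)]
    ring
  · exact (intervalIntegrable_iff_integrableOn_Ioc_of_le neg_pi_le_pi).2 (hint.const_mul I)

/-! ### The measure on the cube -/

/-- The uniform measure on the cube `-π < θ_l ≤ π`. -/
noncomputable def cubeMeasure (N : ℕ) : Measure (Fin N → ℝ) := Measure.pi fun _ => arcMeasure

instance : IsFiniteMeasure arcMeasure := by unfold arcMeasure; infer_instance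

instance (N : ℕ) : IsFiniteMeasure (cubeMeasure N) := by unfold cubeMeasure; infer_instance

theorem cubeMeasure_eq (N : ℕ) : cubeMeasure N =
    volume.restrict (Set.univ.pi fun _ => Set.Ioc (-Real.pi) Real.pi) := by
  rw [cubeMeasure, volume_pi, Measure.restrict_pi_pi]
  rfl

theorem ae_cubeMeasure_mem (N : ℕ) :
    ∀ᵐ θ ∂cubeMeasure N, ∀ l, θ l ∈ Set.Ioc (-Real.pi) Real.pi := by
  rw [cubeMeasure_eq]
  filter_upwards [ae_restrict_mem (MeasurableSet.univ_pi fun _ => measurableSet_Ioc)] with θ h l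
  exact h l trivial

theorem exists_ae_norm_le {N : ℕ} {f : (Fin N → ℝ) → ℂ} (hf : Continuous f) :
    ∃ C, ∀ᵐ θ ∂cubeMeasure N, ‖f θ‖ ≤ C := by
  obtain ⟨C, hC⟩ := (isCompact_univ_pi fun _ : Fin N => isCompact_Icc (a := -Real.pi)
    (b := Real.pi)).exists_bound_of_continuousOn hf.continuousOn
  exact ⟨C, (ae_cubeMeasure_mem N).mono fun θ h => hC θ fun l _ => Set.Ioc_subset_Icc_self (h l)⟩

theorem integral_comp_perm {N : ℕ} (σ : Equiv.Perm (Fin N)) (f : (Fin N → ℝ) → ℂ) :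
    ∫ θ, f (θ ∘ σ) ∂cubeMeasure N = ∫ θ, f θ ∂cubeMeasure N := by
  have h := measurePreserving_piCongrLeft (fun _ : Fin N => arcMeasure) σ.symm
  have e (θ : Fin N → ℝ) : MeasurableEquiv.piCongrLeft (fun _ : Fin N => ℝ) σ.symm θ = θ ∘ σ := by
    funext l
    obtain ⟨m, rfl⟩ := σ.symm.surjective l
    rw [MeasurableEquiv.coe_piCongrLeft, Equiv.piCongrLeft_apply_apply]
    simp
  have h2 := h.integral_comp (MeasurableEquiv.measurableEmbedding _) f
  simp only [e] at h2
  exact h2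

theorem integral_eq_zero_of_slice {M : ℕ} (i : Fin (M + 1)) {f : (Fin (M + 1) → ℝ) → ℂ}
    (hf : Integrable f (cubeMeasure (M + 1)))
    (h0 : ∀ θ, ∫ t, f (Function.update θ i t) ∂arcMeasure = 0) :
    ∫ θ, f θ ∂cubeMeasure (M + 1) = 0 := by
  have h := (measurePreserving_piFinSuccAbove (fun _ : Fin (M + 1) => arcMeasure) i).symm
  have he := (MeasurableEquiv.piFinSuccAbove (fun _ : Fin (M + 1) => ℝ) i).symm.measurableEmbedding
  rw [cubeMeasure, ← h.integral_comp he]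
  refine (integral_prod_symm _ ((h.integrable_comp_emb he).2 hf)).trans ?_
  refine integral_eq_zero_of_ae (Eventually.of_forall fun θ' => ?_)
  have := h0 (i.insertNth 0 θ')
  simp only [Fin.update_insertNth] at this
  exact this

/-- Integrating first over the angle `i`, translation invariance makes the inner integral
independent of the other angle, and a product of one-variable functions remains. -/
theorem integrable_chord_mul_prod {M : ℕ} (i : Fin (M + 1)) (k : Fin M) {c : ℝ} (hc : -1 < c)
    {g : ℝ → ℝ} (hg : Integrable g arcMeasure) :
    Integrable (fun θ : Fin (M + 1) → ℝ => chord (θ (i.succAbove k) - θ i) ^ c *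
      ∏ l, g (θ (i.succAbove l))) (cubeMeasure (M + 1)) := by
  have h := (measurePreserving_piFinSuccAbove (fun _ : Fin (M + 1) => arcMeasure) i).symm
  have he := (MeasurableEquiv.piFinSuccAbove (fun _ : Fin (M + 1) => ℝ) i).symm.measurableEmbedding
  rw [cubeMeasure, ← h.integrable_comp_emb he]
  have e : (fun θ : Fin (M + 1) → ℝ => chord (θ (i.succAbove k) - θ i) ^ c *
      ∏ l, g (θ (i.succAbove l))) ∘ (MeasurableEquiv.piFinSuccAbove (fun _ : Fin (M + 1) => ℝ) i).symm
      = fun p : ℝ × (Fin M → ℝ) => chord (p.2 k - p.1) ^ c * ∏ l, g (p.2 l) := by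
    funext p
    simp [MeasurableEquiv.piFinSuccAbove, Fin.insertNthEquiv]
  rw [e]
  have hG : Integrable (fun θ : Fin M → ℝ => ∏ l, g (θ l)) (Measure.pi fun _ => arcMeasure) :=
    Integrable.fintype_prod fun _ => hg
  have hm : Measurable fun p : ℝ × (Fin M → ℝ) => chord (p.2 k - p.1) ^ c :=
    Measurable.pow_const (continuous_chord.measurable.comp (by fun_prop)) c
  refine (integrable_prod_iff' (hm.aestronglyMeasurable.mul hG.aestronglyMeasurable.comp_snd)).2
    ⟨Eventually.of_forall fun θ => (integrable_chord_sub_rpow hc (θ k)).mul_const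
      (∏ l, g (θ l)), ?_⟩
  refine (hG.norm.const_mul (∫ t, chord t ^ c ∂arcMeasure)).congr (Eventually.of_forall fun θ => ?_)
  simp only [Pi.mul_apply, norm_mul]
  rw [integral_mul_const, ← integral_chord_sub_rpow c (θ k)]
  congr 1
  refine integral_congr_ae (Eventually.of_forall fun t => ?_)
  exact (Real.norm_of_nonneg (Real.rpow_nonneg (chord_nonneg _) _)).symm

/-! ### The Boltzmann factor -/

/-- The product over ordered pairs with half the exponent is visibly symmetric, and a single angle
is easily split off from it. -/
theorem boltzmannFactor_eq (β : ℝ) {N : ℕ} (θ : Fin N → ℝ) : boltzmannFactor β N θ =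
    ∏ j, ∏ k, if k = j then 1 else chord (θ k - θ j) ^ (β / 2) := by
  have h := Finset.prod_prod_Ioi_mul_eq_prod_prod_off_diag
    fun k j : Fin N => chord (θ k - θ j) ^ (β / 2)
  rw [boltzmannFactor]
  calc _ = ∏ i, ∏ j ∈ Finset.Ioi i, chord (θ j - θ i) ^ (β / 2) * chord (θ i - θ j) ^ (β / 2) := by
        refine Finset.prod_congr rfl fun j _ => Finset.prod_congr rfl fun k hk => ?_
        rw [← chord_neg (θ j - θ k), neg_sub, ← sq, ← Real.rpow_natCast, ← Real.rpow_mul (chord_nonneg _)]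
        rw [← norm_circ_sub_circ, circ, circ]
        congr 1; push_cast; ring
    _ = _ := by
        rw [h]
        refine Finset.prod_congr rfl fun j _ => ?_
        rw [Fintype.prod_eq_mul_prod_compl j, if_pos rfl, one_mul]
        exact Finset.prod_congr rfl fun k hk => by rw [if_neg (by simpa using hk)]

theorem continuous_boltzmannFactor {β : ℝ} (hβ : 0 < β) (N : ℕ) :
    Continuous (boltzmannFactor β N) := by
  unfold boltzmannFactor
  refine continuous_finsetProd _ fun j _ => continuous_finsetProd _ fun k _ => ?_
  exact Continuous.rpow_const (by fun_prop) fun _ => Or.inr hβ.le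

theorem boltzmannFactor_nonneg (β : ℝ) {N : ℕ} (θ : Fin N → ℝ) : 0 ≤ boltzmannFactor β N θ :=
  Finset.prod_nonneg fun _ _ => Finset.prod_nonneg fun _ _ => Real.rpow_nonneg (norm_nonneg _) _

theorem boltzmannFactor_comp_perm (β : ℝ) {N : ℕ} (θ : Fin N → ℝ) (σ : Equiv.Perm (Fin N)) :
    boltzmannFactor β N (θ ∘ σ) = boltzmannFactor β N θ := by
  rw [boltzmannFactor_eq, boltzmannFactor_eq,
    ← Equiv.prod_comp σ fun j => ∏ k, if k = j then 1 else chord (θ k - θ j) ^ (β / 2)]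
  refine Finset.prod_congr rfl fun j _ => ?_
  refine Eq.trans ?_ (Equiv.prod_comp σ _)
  simp

/-- The part of the Boltzmann factor which does not involve the angle with index `i`. -/
noncomputable def boltzmannRest (β : ℝ) {N : ℕ} (i : Fin N) (θ : Fin N → ℝ) : ℝ :=
  ∏ j ∈ {i}ᶜ, ∏ k ∈ {i}ᶜ, if k = j then 1 else chord (θ k - θ j) ^ (β / 2)

theorem boltzmannFactor_eq_mul_rest (β : ℝ) {N : ℕ} (i : Fin N) (θ : Fin N → ℝ) :
    boltzmannFactor β N θ = (∏ k ∈ {i}ᶜ, chord (θ k - θ i) ^ β) * boltzmannRest β i θ := by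
  rw [boltzmannFactor_eq, Fintype.prod_eq_mul_prod_compl i, Fintype.prod_eq_mul_prod_compl i,
    if_pos rfl, one_mul, boltzmannRest]
  have : ∏ j ∈ {i}ᶜ, ∏ k, (if k = j then 1 else chord (θ k - θ j) ^ (β / 2)) =
      (∏ j ∈ {i}ᶜ, chord (θ j - θ i) ^ (β / 2)) *
      ∏ j ∈ {i}ᶜ, ∏ k ∈ {i}ᶜ, if k = j then 1 else chord (θ k - θ j) ^ (β / 2) := by
    rw [← Finset.prod_mul_distrib]
    refine Finset.prod_congr rfl fun j hj => ?_
    rw [Fintype.prod_eq_mul_prod_compl i, if_neg (by simpa [eq_comm] using hj), ← chord_neg, neg_sub]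
  rw [this, ← mul_assoc, ← Finset.prod_mul_distrib]
  congr 1
  refine Finset.prod_congr rfl fun j hj => ?_
  rw [if_neg (by simpa using hj), ← sq, ← Real.rpow_natCast, ← Real.rpow_mul (chord_nonneg _)]
  congr 1; push_cast; ring

theorem continuous_boltzmannRest {β : ℝ} (hβ : 0 < β) {N : ℕ} (i : Fin N) :
    Continuous (boltzmannRest β i) := by
  unfold boltzmannRest
  refine continuous_finsetProd _ fun j _ => continuous_finsetProd _ fun k _ => ?_
  split_ifs
  · exact continuous_const
  · exact (continuous_chord.comp (by fun_prop)).rpow_const fun _ => Or.inr (by linarith)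

theorem boltzmannRest_update (β : ℝ) {N : ℕ} (i : Fin N) (θ : Fin N → ℝ) (t : ℝ) :
    boltzmannRest β i (Function.update θ i t) = boltzmannRest β i θ := by
  unfold boltzmannRest
  refine Finset.prod_congr rfl fun j hj => Finset.prod_congr rfl fun k hk => ?_
  rw [Function.update_of_ne (by simpa using hk), Function.update_of_ne (by simpa using hj)]

/-- The density of the Morris integral. -/
noncomputable def density (A D : ℂ) (β : ℝ) {N : ℕ} (θ : Fin N → ℝ) : ℂ :=
  (∏ l, weight A D (θ l)) * (boltzmannFactor β N θ : ℂ)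

/-- The Morris integral. -/
noncomputable def morris (A D : ℂ) (β : ℝ) (N : ℕ) : ℂ :=
  ∫ θ, density A D β θ ∂cubeMeasure N

/-- The Morris integral with additional factors `1 + e^{i θ_l}` for `l ∈ S`. -/
noncomputable def aomoto (A D : ℂ) (β : ℝ) {N : ℕ} (S : Finset (Fin N)) : ℂ :=
  ∫ θ, (∏ l ∈ S, (1 + circ (θ l))) * density A D β θ ∂cubeMeasure N

theorem integrable_prod_weight {A : ℂ} (hA : -1 < A.re) (D : ℂ) (N : ℕ) :
    Integrable (fun θ : Fin N → ℝ => ∏ l, weight A D (θ l)) (cubeMeasure N) :=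
  Integrable.fintype_prod fun _ => integrable_weight hA D

theorem integrable_mul_density {A : ℂ} (hA : -1 < A.re) (D : ℂ) {β : ℝ} (hβ : 0 < β) {N : ℕ}
    {f : (Fin N → ℝ) → ℂ} (hf : Continuous f) :
    Integrable (fun θ => f θ * density A D β θ) (cubeMeasure N) := by
  have hc : Continuous fun θ => f θ * (boltzmannFactor β N θ : ℂ) :=
    hf.mul (continuous_ofReal.comp (continuous_boltzmannFactor hβ N))
  obtain ⟨C, hC⟩ := exists_ae_norm_le hc
  refine ((integrable_prod_weight hA D N).bdd_mul hc.aestronglyMeasurable hC).congr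
    (Eventually.of_forall fun θ => ?_)
  simp only [density]
  ring

theorem measurable_density (A D : ℂ) {β : ℝ} (hβ : 0 < β) {N : ℕ} :
    Measurable fun θ : Fin N → ℝ => density A D β θ := by
  have h1 : Measurable fun θ : Fin N → ℝ => ∏ l, weight A D (θ l) :=
    Finset.measurable_fun_prod _ fun l _ => (measurable_weight A D).comp (measurable_pi_apply l)
  exact h1.mul (continuous_ofReal.comp (continuous_boltzmannFactor hβ N)).measurable

theorem density_comp_perm (A D : ℂ) (β : ℝ) {N : ℕ} (θ : Fin N → ℝ) (σ : Equiv.Perm (Fin N)) :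
    density A D β (θ ∘ σ) = density A D β θ := by
  rw [density, density, boltzmannFactor_comp_perm]
  congr 1
  exact Equiv.prod_comp σ fun l => weight A D (θ l)

theorem measurable_cotKernel : Measurable fun p : ℝ × ℝ => cotKernel p.1 p.2 := by
  unfold cotKernel
  have := continuous_circ.measurable
  fun_prop

theorem norm_cotKernel_mul_le {β t φ : ℝ} :
    ‖cotKernel t φ * ((chord (φ - t) ^ β : ℝ) : ℂ)‖ ≤ 2 * chord (φ - t) ^ (β - 1) := by
  have hn : ‖circ t + circ φ‖ ≤ 2 := (norm_add_le _ _).trans (by rw [norm_circ, norm_circ]; norm_num)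
  rw [norm_mul, norm_real, Real.norm_of_nonneg (Real.rpow_nonneg (chord_nonneg _) _), cotKernel,
    norm_div, norm_circ_sub_circ, ← chord_neg (t - φ), neg_sub]
  rcases (chord_nonneg (φ - t)).eq_or_lt with h | h
  · rw [← h, div_zero, zero_mul]
    exact mul_nonneg zero_le_two (Real.rpow_nonneg le_rfl _)
  · rw [Real.rpow_sub_one h.ne', div_mul_eq_mul_div, mul_div_assoc]
    gcongr

/-- The factor `1 + e^{iθ_i}` makes the weight at `i` bounded. What is left is a pair singularity of
exponent `β - 1 > -1` and the integrable weights of the other angles. -/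
theorem integrable_cotKernel_term {A : ℂ} (hA : -1 < A.re) (D : ℂ) {β : ℝ} (hβ : 0 < β) {N : ℕ}
    (S : Finset (Fin N)) {i k : Fin N} (hk : k ≠ i) :
    Integrable (fun θ => (∏ l ∈ S, (1 + circ (θ l))) *
      ((1 + circ (θ i)) * cotKernel (θ i) (θ k)) * density A D β θ) (cubeMeasure N) := by
  obtain ⟨M, rfl⟩ : ∃ M, N = M + 1 := ⟨N - 1, by have := i.pos; omega⟩
  obtain ⟨k, rfl⟩ := Fin.exists_succAbove_eq hk
  have hc : Continuous fun θ : Fin (M + 1) → ℝ => (∏ l ∈ S, (1 + circ (θ l))) *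
      (((∏ m ∈ ({i}ᶜ : Finset (Fin (M + 1))).erase (i.succAbove k), chord (θ m - θ i) ^ β) *
        boltzmannRest β i θ : ℝ) : ℂ) := by
    refine (continuous_finsetProd _ fun l _ => continuous_const.add
      (continuous_circ.comp (continuous_apply l))).mul (continuous_ofReal.comp
        ((continuous_finsetProd _ fun l _ => ?_).mul (continuous_boltzmannRest hβ i)))
    exact (continuous_chord.comp (by fun_prop)).rpow_const fun _ => Or.inr hβ.le
  obtain ⟨C, hC⟩ := exists_ae_norm_le hc
  have hA1 : 0 < (A + 1).re := by simp; linarith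
  have hw : Continuous fun θ : Fin (M + 1) → ℝ => weight (A + 1) (D + 1) (θ i) :=
    (continuous_weight hA1 (D + 1)).comp (continuous_apply i)
  obtain ⟨C', hC'⟩ := exists_ae_norm_le hw
  have hI := integrable_chord_mul_prod i k (c := β - 1) (by linarith) (integrable_weight hA D).norm
  have hmeas : Measurable fun θ : Fin (M + 1) → ℝ => (∏ l ∈ S, (1 + circ (θ l))) *
      ((1 + circ (θ i)) * cotKernel (θ i) (θ (i.succAbove k))) * density A D β θ := by
    have m1 : Measurable fun θ : Fin (M + 1) → ℝ => ∏ l ∈ S, (1 + circ (θ l)) :=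
      (continuous_finsetProd _ fun l _ => continuous_const.add
        (continuous_circ.comp (continuous_apply l))).measurable
    have m2 : Measurable fun θ : Fin (M + 1) → ℝ => 1 + circ (θ i) :=
      (continuous_const.add (continuous_circ.comp (continuous_apply i))).measurable
    have m3 : Measurable fun θ : Fin (M + 1) → ℝ => (θ i, θ (i.succAbove k)) := by fun_prop
    exact (m1.mul (m2.mul (measurable_cotKernel.comp m3))).mul (measurable_density A D hβ)
  refine (hI.const_mul (C * C' * 2)).mono' hmeas.aestronglyMeasurable ?_
  filter_upwards [hC, hC', ae_cubeMeasure_mem (M + 1)] with θ h1 h2 hθ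
  rw [← one_add_circ_mul_weight hA D (Set.Ioc_subset_Icc_self (hθ i))] at h2
  have e : (∏ l ∈ S, (1 + circ (θ l))) *
      ((1 + circ (θ i)) * cotKernel (θ i) (θ (i.succAbove k))) * density A D β θ =
      ((∏ l ∈ S, (1 + circ (θ l))) *
      (((∏ m ∈ ({i}ᶜ : Finset (Fin (M + 1))).erase (i.succAbove k), chord (θ m - θ i) ^ β) *
        boltzmannRest β i θ : ℝ) : ℂ)) * ((1 + circ (θ i)) * weight A D (θ i)) *
      (cotKernel (θ i) (θ (i.succAbove k)) * ((chord (θ (i.succAbove k) - θ i) ^ β : ℝ) : ℂ)) *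
      ∏ l, weight A D (θ (i.succAbove l)) := by
    rw [density, boltzmannFactor_eq_mul_rest β i, Fin.prod_univ_succAbove _ i,
      ← Finset.mul_prod_erase ({i}ᶜ : Finset (Fin (M + 1))) _ (a := i.succAbove k) (by simp)]
    push_cast
    ring
  rw [e, norm_mul, norm_mul, norm_mul, norm_prod]
  calc _ ≤ C * C' * (2 * chord (θ (i.succAbove k) - θ i) ^ (β - 1)) *
        ∏ l, ‖weight A D (θ (i.succAbove l))‖ := by
        have hC0 := (norm_nonneg _).trans h1
        have hC1 := mul_nonneg hC0 ((norm_nonneg _).trans h2)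
        gcongr
        exact norm_cotKernel_mul_le
    _ = _ := by ring

theorem aomoto_swap (A D : ℂ) (β : ℝ) {N : ℕ} (S : Finset (Fin N)) {i k : Fin N} (hi : i ∉ S)
    (hk : k ∉ S) : aomoto A D β (insert k S) = aomoto A D β (insert i S) := by
  rw [aomoto, ← integral_comp_perm (Equiv.swap i k), aomoto]
  congr 1
  funext θ
  rw [density_comp_perm, Finset.prod_insert hi, Finset.prod_insert hk]
  congr 2
  · simp
  · refine Finset.prod_congr rfl fun l hl => ?_
    rw [Function.comp_apply, Equiv.swap_apply_of_ne_of_ne (ne_of_mem_of_not_mem hl hi)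
      (ne_of_mem_of_not_mem hl hk)]

theorem density_eq_zero {β : ℝ} (hβ : 0 < β) (A D : ℂ) {N : ℕ} {θ : Fin N → ℝ} {i k : Fin N}
    (hk : k ≠ i) (h : circ (θ i) = circ (θ k)) : density A D β θ = 0 := by
  have : chord (θ k - θ i) ^ β = 0 := by
    rw [← norm_circ_sub_circ, h, sub_self, norm_zero, Real.zero_rpow hβ.ne']
  rw [density, boltzmannFactor_eq_mul_rest β i,
    Finset.prod_eq_zero (s := {i}ᶜ) (i := k) (by simpa using hk) this]
  simp

/-- Average over the exchange of `θ_i` and `θ_k`, under which the kernel is odd. For `k ∈ S` its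
prefactor is symmetric and the integral vanishes. Otherwise, with `x = e^{iθ}`, the two copies add
up to `(x_i - x_k) * cotKernel = (1 + x_i) + (1 + x_k) - 2`. -/
theorem integral_cotKernel_term {A : ℂ} (hA : -1 < A.re) (D : ℂ) {β : ℝ} (hβ : 0 < β) {N : ℕ}
    (S : Finset (Fin N)) {i k : Fin N} (hi : i ∉ S) (hk : k ≠ i) :
    ∫ θ, (∏ l ∈ S, (1 + circ (θ l))) * ((1 + circ (θ i)) * cotKernel (θ i) (θ k)) *
      density A D β θ ∂cubeMeasure N =
      if k ∈ S then 0 else aomoto A D β (insert i S) - aomoto A D β S := by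
  set T : (Fin N → ℝ) → ℂ := fun θ => (∏ l ∈ S, (1 + circ (θ l))) *
    ((1 + circ (θ i)) * cotKernel (θ i) (θ k)) * density A D β θ with hT
  have hTi : Integrable T (cubeMeasure N) := integrable_cotKernel_term hA D hβ S hk
  have hTs : ∫ θ, T (θ ∘ Equiv.swap i k) ∂cubeMeasure N = ∫ θ, T θ ∂cubeMeasure N :=
    integral_comp_perm _ _
  split_ifs with hkS
  · have e (θ : Fin N → ℝ) : T (θ ∘ Equiv.swap i k) = -T θ := by
      simp only [hT]
      rw [density_comp_perm, ← Finset.mul_prod_erase S _ hkS, ← Finset.mul_prod_erase S _ hkS]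
      have : ∏ l ∈ S.erase k, (1 + circ ((θ ∘ Equiv.swap i k) l)) =
          ∏ l ∈ S.erase k, (1 + circ (θ l)) := by
        refine Finset.prod_congr rfl fun l hl => ?_
        rw [Function.comp_apply, Equiv.swap_apply_of_ne_of_ne
          (ne_of_mem_of_not_mem (Finset.mem_of_mem_erase hl) hi) (Finset.ne_of_mem_erase hl)]
      rw [this]
      simp only [Function.comp_apply, Equiv.swap_apply_left, Equiv.swap_apply_right]
      rw [cotKernel_swap (θ i)]
      ring
    simp only [e, integral_neg] at hTs
    linear_combination (-1 / 2 : ℂ) * hTs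
  · have e (θ : Fin N → ℝ) : T θ + T (θ ∘ Equiv.swap i k) =
        (∏ l ∈ insert i S, (1 + circ (θ l))) * density A D β θ +
        (∏ l ∈ insert k S, (1 + circ (θ l))) * density A D β θ -
        2 * ((∏ l ∈ S, (1 + circ (θ l))) * density A D β θ) := by
      simp only [hT]
      rw [density_comp_perm, Finset.prod_insert hi, Finset.prod_insert hkS]
      have : ∏ l ∈ S, (1 + circ ((θ ∘ Equiv.swap i k) l)) = ∏ l ∈ S, (1 + circ (θ l)) := by
        refine Finset.prod_congr rfl fun l hl => ?_
        rw [Function.comp_apply, Equiv.swap_apply_of_ne_of_ne (ne_of_mem_of_not_mem hl hi)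
          (ne_of_mem_of_not_mem hl hkS)]
      rw [this]
      simp only [Function.comp_apply, Equiv.swap_apply_left, Equiv.swap_apply_right]
      rw [cotKernel_swap (θ i)]
      by_cases hx : circ (θ i) = circ (θ k)
      · rw [density_eq_zero hβ A D hk hx]; ring
      · have hk' : cotKernel (θ i) (θ k) * (circ (θ i) - circ (θ k)) = circ (θ i) + circ (θ k) := by
          rw [cotKernel, div_mul_cancel₀ _ (sub_ne_zero.2 hx)]
        linear_combination (∏ l ∈ S, (1 + circ (θ l))) * density A D β θ * hk'
    have hc (S' : Finset (Fin N)) : Integrable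
        (fun θ => (∏ l ∈ S', (1 + circ (θ l))) * density A D β θ) (cubeMeasure N) :=
      integrable_mul_density hA D hβ (continuous_finsetProd _ fun l _ => continuous_const.add
        (continuous_circ.comp (continuous_apply l)))
    have hT' : Integrable (fun θ => T (θ ∘ Equiv.swap i k)) (cubeMeasure N) := by
      have : (fun θ => T (θ ∘ Equiv.swap i k)) = fun θ =>
        ((∏ l ∈ insert i S, (1 + circ (θ l))) * density A D β θ +
        (∏ l ∈ insert k S, (1 + circ (θ l))) * density A D β θ -
        2 * ((∏ l ∈ S, (1 + circ (θ l))) * density A D β θ)) - T θ := by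
        funext θ; rw [← e]; ring
      rw [this]
      exact (((hc _).add (hc _)).sub ((hc _).const_mul 2)).sub hTi
    have h := integral_add hTi hT'
    have hadd : Integrable (fun θ => (∏ l ∈ insert i S, (1 + circ (θ l))) * density A D β θ +
        (∏ l ∈ insert k S, (1 + circ (θ l))) * density A D β θ) (cubeMeasure N) := (hc _).add (hc _)
    simp only [e] at h
    rw [integral_sub hadd ((hc _).const_mul 2), integral_add (hc _) (hc _),
      integral_const_mul, hTs] at h
    change aomoto A D β (insert i S) + aomoto A D β (insert k S) - 2 * aomoto A D β S = _ at h
    rw [aomoto_swap A D β S hi hkS] at h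
    linear_combination (-1 / 2 : ℂ) * h

/-- Integrate by parts in `θ_i`. Among the indices `k ≠ i`, exactly `N - 1 - |S|` lie outside `S`,
and each contributes the same difference of integrals. -/
theorem aomoto_insert {A : ℂ} (hA : -1 < A.re) (D : ℂ) {β : ℝ} (hβ : 0 < β) {N : ℕ}
    (S : Finset (Fin N)) {i : Fin N} (hi : i ∉ S) :
    ((A + D) / 2 + 1 + β / 2 * (N - 1 - S.card)) * aomoto A D β (insert i S) =
      (A + 1 + β / 2 * (N - 1 - S.card)) * aomoto A D β S := by
  obtain ⟨M, rfl⟩ : ∃ M, N = M + 1 := ⟨N - 1, by have := i.pos; omega⟩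
  have hc (S' : Finset (Fin (M + 1))) : Integrable
      (fun θ => (∏ l ∈ S', (1 + circ (θ l))) * density A D β θ) (cubeMeasure (M + 1)) :=
    integrable_mul_density hA D hβ (continuous_finsetProd _ fun l _ => continuous_const.add
      (continuous_circ.comp (continuous_apply l)))
  set a := (A + D) / 2 + 1
  set b := (A - D) / 2
  set T : Fin (M + 1) → (Fin (M + 1) → ℝ) → ℂ := fun k θ => (∏ l ∈ S, (1 + circ (θ l))) *
    ((1 + circ (θ i)) * cotKernel (θ i) (θ k)) * density A D β θ with hT
  have hTi (k) (hk : k ∈ ({i}ᶜ : Finset (Fin (M + 1)))) : Integrable (T k) (cubeMeasure (M + 1)) :=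
    integrable_cotKernel_term hA D hβ S (by simpa using hk)
  have hsum : Integrable (fun θ => ∑ k ∈ {i}ᶜ, T k θ) (cubeMeasure (M + 1)) :=
    integrable_finsetSum _ hTi
  have e (θ : Fin (M + 1) → ℝ) : a * ((∏ l ∈ insert i S, (1 + circ (θ l))) * density A D β θ) -
      (a + b) * ((∏ l ∈ S, (1 + circ (θ l))) * density A D β θ) +
      (β / 2) * ∑ k ∈ {i}ᶜ, T k θ =
      (∏ l ∈ S, (1 + circ (θ l))) * ((a * circ (θ i) - b) +
        (1 + circ (θ i)) * ((β / 2) * ∑ k ∈ {i}ᶜ, cotKernel (θ i) (θ k))) * density A D β θ := by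
    rw [Finset.prod_insert hi]
    simp only [hT]
    rw [← Finset.sum_mul, ← Finset.mul_sum, ← Finset.mul_sum]
    ring
  have h1 : Integrable (fun θ => a * ((∏ l ∈ insert i S, (1 + circ (θ l))) * density A D β θ))
    (cubeMeasure (M + 1)) := (hc _).const_mul _
  have h2 : Integrable (fun θ => (a + b) * ((∏ l ∈ S, (1 + circ (θ l))) * density A D β θ))
    (cubeMeasure (M + 1)) := (hc _).const_mul _
  have h3 : Integrable (fun θ => ((β : ℂ) / 2) * ∑ k ∈ {i}ᶜ, T k θ) (cubeMeasure (M + 1)) :=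
    hsum.const_mul _
  -- With the other angles frozen, the integrand is a constant times the exact derivative in `θ_i`.
  have h0 := integral_eq_zero_of_slice i ((h1.sub h2).add h3) fun θ => by
    have hz := congrArg (fun z => (∏ l ∈ S, (1 + circ (θ l))) * (∏ l ∈ {i}ᶜ, weight A D (θ l)) *
      (boltzmannRest β i θ : ℂ) * z) (integral_deriv_weight_mul_prod hA D hβ {i}ᶜ θ)
    simp only [mul_zero] at hz
    rw [← hz, ← integral_const_mul]
    refine integral_congr_ae (Eventually.of_forall fun t => ?_)
    simp only [Pi.add_apply, Pi.sub_apply]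
    rw [e, density, boltzmannFactor_eq_mul_rest β i, boltzmannRest_update,
      Fintype.prod_eq_mul_prod_compl i]
    have p1 : ∏ l ∈ S, (1 + circ (Function.update θ i t l)) = ∏ l ∈ S, (1 + circ (θ l)) :=
      Finset.prod_congr rfl fun l hl => by
        rw [Function.update_of_ne (ne_of_mem_of_not_mem hl hi)]
    have p2 : ∏ l ∈ {i}ᶜ, weight A D (Function.update θ i t l) = ∏ l ∈ {i}ᶜ, weight A D (θ l) :=
      Finset.prod_congr rfl fun l hl => by rw [Function.update_of_ne (by simpa using hl)]
    have p3 : ∑ l ∈ {i}ᶜ, cotKernel t (Function.update θ i t l) = ∑ l ∈ {i}ᶜ, cotKernel t (θ l) :=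
      Finset.sum_congr rfl fun l hl => by rw [Function.update_of_ne (by simpa using hl)]
    have p4 : ∏ l ∈ {i}ᶜ, chord (Function.update θ i t l - t) ^ β =
        ∏ l ∈ {i}ᶜ, chord (θ l - t) ^ β :=
      Finset.prod_congr rfl fun l hl => by rw [Function.update_of_ne (by simpa using hl)]
    rw [Function.update_self, p1, p2, p3, p4]
    push_cast
    ring
  simp only [Pi.add_apply, Pi.sub_apply] at h0
  have hsub : Integrable (fun θ => a * ((∏ l ∈ insert i S, (1 + circ (θ l))) * density A D β θ) -
    (a + b) * ((∏ l ∈ S, (1 + circ (θ l))) * density A D β θ)) (cubeMeasure (M + 1)) := h1.sub h2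
  rw [integral_add hsub h3, integral_sub h1 h2, integral_const_mul, integral_const_mul,
    integral_const_mul, integral_finsetSum _ hTi] at h0
  have hval : ∑ k ∈ ({i}ᶜ : Finset (Fin (M + 1))), ∫ θ, T k θ ∂cubeMeasure (M + 1) =
      ((M + 1 : ℕ) - 1 - S.card) * (aomoto A D β (insert i S) - aomoto A D β S) := by
    rw [Finset.sum_congr rfl fun k hk => integral_cotKernel_term hA D hβ S hi (by simpa using hk),
      Finset.sum_ite, Finset.sum_const_zero, zero_add, Finset.sum_const, nsmul_eq_mul]
    congr 1
    have : ({i}ᶜ : Finset (Fin (M + 1))).filter (fun k => k ∉ S) = (insert i S)ᶜ := by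
      ext k; simp
    rw [this, Finset.card_compl, Finset.card_insert_of_notMem hi, Fintype.card_fin,
      Nat.cast_sub]
    · push_cast; ring
    · rw [← Finset.card_insert_of_notMem hi]
      simpa using Finset.card_le_univ (insert i S)
  rw [hval] at h0
  change a * aomoto A D β (insert i S) - (a + b) * aomoto A D β S + _ = 0 at h0
  have hab : A + 1 = a + b := by simp only [a, b]; ring
  rw [hab]
  linear_combination h0

theorem aomoto_mul_prod {A : ℂ} (hA : -1 < A.re) (D : ℂ) {β : ℝ} (hβ : 0 < β) {N : ℕ}
    (S : Finset (Fin N)) :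
    (∏ j ∈ Finset.range S.card, ((A + D) / 2 + 1 + β / 2 * (N - 1 - j))) * aomoto A D β S =
      (∏ j ∈ Finset.range S.card, (A + 1 + β / 2 * (N - 1 - j))) * aomoto A D β (∅ : Finset (Fin N)) := by
  induction S using Finset.induction_on with
  | empty => simp
  | insert i S hi ih =>
    rw [Finset.card_insert_of_notMem hi, Finset.prod_range_succ, Finset.prod_range_succ, mul_assoc,
      aomoto_insert hA D hβ S hi, mul_left_comm, ih]
    ring

theorem prod_range_reflect_linear (N : ℕ) (x y : ℂ) :
    ∏ j ∈ Finset.range N, (x + y * (N - 1 - j)) = ∏ j ∈ Finset.range N, (x + y * j) := by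
  rw [← Finset.prod_range_reflect]
  refine Finset.prod_congr rfl fun j hj => ?_
  have : j + 1 ≤ N := Finset.mem_range.1 hj
  rw [Nat.sub_sub, Nat.cast_sub (by omega)]
  push_cast
  ring

theorem morris_add_one_add_one {A : ℂ} (hA : -1 < A.re) (D : ℂ) {β : ℝ} (hβ : 0 < β) (N : ℕ) :
    (∏ j ∈ Finset.range N, ((A + D) / 2 + 1 + β / 2 * j)) * morris (A + 1) (D + 1) β N =
      (∏ j ∈ Finset.range N, (A + 1 + β / 2 * j)) * morris A D β N := by
  have h := aomoto_mul_prod hA D hβ (Finset.univ : Finset (Fin N))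
  rw [Finset.card_univ, Fintype.card_fin, prod_range_reflect_linear, prod_range_reflect_linear] at h
  have e1 : aomoto A D β (Finset.univ : Finset (Fin N)) = morris (A + 1) (D + 1) β N := by
    refine integral_congr_ae ((ae_cubeMeasure_mem N).mono fun θ hθ => ?_)
    simp only [density]
    rw [← mul_assoc, ← Finset.prod_mul_distrib]
    congr 1
    exact Finset.prod_congr rfl fun l _ =>
      one_add_circ_mul_weight hA D (Set.Ioc_subset_Icc_self (hθ l))
  have e2 : aomoto A D β (∅ : Finset (Fin N)) = morris A D β N := by
    simp [aomoto, morris]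
  rwa [e1, e2] at h

open ComplexConjugate in
-- Conjugation reverses the sign of `D`, turning the step `D + 1` of the recursion into `D - 1`.
theorem morris_conj (A D : ℂ) (β : ℝ) (N : ℕ) :
    morris (conj A) (-conj D) β N = conj (morris A D β N) := by
  rw [morris, morris, ← integral_conj]
  congr 1
  funext θ
  rw [density, density, map_mul, conj_ofReal, map_prod]
  congr 1
  refine Finset.prod_congr rfl fun l _ => ?_
  rw [weight, weight, map_mul, ← exp_conj]
  congr 1
  · congr 1
    rw [map_div₀, map_mul, map_mul, conj_I, conj_ofReal, map_ofNat]
    ring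
  · rw [cpow_conj, conj_ofReal]
    rw [arg_ofReal_of_nonneg (norm_nonneg _)]
    exact Real.pi_pos.ne

open ComplexConjugate in
theorem morris_add_one_sub_one {A : ℂ} (hA : -1 < A.re) (D : ℂ) {β : ℝ} (hβ : 0 < β) (N : ℕ) :
    (∏ j ∈ Finset.range N, ((A - D) / 2 + 1 + β / 2 * j)) * morris (A + 1) (D - 1) β N =
      (∏ j ∈ Finset.range N, (A + 1 + β / 2 * j)) * morris A D β N := by
  have h := congrArg conj (morris_add_one_add_one (A := conj A) (by simpa using hA) (-conj D) hβ N)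
  rw [morris_conj, show conj A + 1 = conj (A + 1) by simp,
    show -conj D + 1 = -conj (D - 1) by simp; ring, morris_conj] at h
  simpa [sub_eq_add_neg, map_ofNat] using h

theorem morris_add_two {A : ℂ} (hA : -1 < A.re) (D : ℂ) {β : ℝ} (hβ : 0 < β) (N : ℕ) :
    (∏ j ∈ Finset.range N, (((A + D) / 2 + 1 + β / 2 * j) * ((A - D) / 2 + 1 + β / 2 * j))) *
      morris (A + 2) D β N =
      (∏ j ∈ Finset.range N, ((A + 1 + β / 2 * j) * (A + 2 + β / 2 * j))) * morris A D β N := by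
  have h1 := morris_add_one_add_one hA D hβ N
  have h2 := morris_add_one_sub_one (A := A + 1) (by simp; linarith) (D + 1) hβ N
  rw [show A + 1 - (D + 1) = A - D by ring, show A + 1 + 1 = A + 2 by ring,
    add_sub_cancel_right] at h2
  rw [Finset.prod_mul_distrib, Finset.prod_mul_distrib, mul_assoc, h2, mul_left_comm, h1]
  ring

/-! ### Concentration at the origin -/

theorem boltzmannMeasure_eq (β : ℝ) (N : ℕ) : boltzmannMeasure β N =
    (cubeMeasure N).withDensity fun θ => ENNReal.ofReal (boltzmannFactor β N θ) := by
  rw [boltzmannMeasure, cubeMeasure_eq]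

theorem measurable_boltzmannDensity {β : ℝ} (hβ : 0 < β) (N : ℕ) :
    Measurable fun θ : Fin N → ℝ => ENNReal.ofReal (boltzmannFactor β N θ) :=
  (continuous_boltzmannFactor hβ N).measurable.ennreal_ofReal

theorem isFiniteMeasure_boltzmannMeasure {β : ℝ} (hβ : 0 < β) (N : ℕ) :
    IsFiniteMeasure (boltzmannMeasure β N) := by
  rw [boltzmannMeasure_eq]
  have h := (integrable_mul_density (A := 0) (by simp) 0 hβ (N := N)
    (f := fun _ => 1) continuous_const).norm
  refine isFiniteMeasure_withDensity_ofReal (h.congr (Eventually.of_forall fun θ => ?_)).2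
  simp only [one_mul, density, weight, cpow_zero, mul_zero, zero_mul, zero_div, exp_zero,
    Finset.prod_const_one, norm_real]
  exact Real.norm_of_nonneg (boltzmannFactor_nonneg β θ)

theorem integral_boltzmannMeasure {β : ℝ} (hβ : 0 < β) {N : ℕ} (f : (Fin N → ℝ) → ℂ) :
    ∫ θ, f θ ∂boltzmannMeasure β N = ∫ θ, f θ * (boltzmannFactor β N θ : ℂ) ∂cubeMeasure N := by
  rw [boltzmannMeasure_eq, integral_withDensity_eq_integral_toReal_smul
    (measurable_boltzmannDensity hβ N) (Eventually.of_forall fun _ => ENNReal.ofReal_lt_top)]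
  congr 1
  funext θ
  rw [ENNReal.toReal_ofReal (boltzmannFactor_nonneg β θ), real_smul, mul_comm]

theorem integrable_boltzmannMeasure {A : ℂ} (hA : -1 < A.re) (D : ℂ) {β : ℝ} (hβ : 0 < β) (N : ℕ) :
    Integrable (fun θ : Fin N → ℝ => ∏ l, weight A D (θ l)) (boltzmannMeasure β N) := by
  rw [boltzmannMeasure_eq, integrable_withDensity_iff_integrable_smul'
    (measurable_boltzmannDensity hβ N) (Eventually.of_forall fun _ => ENNReal.ofReal_lt_top)]
  refine (integrable_mul_density hA D hβ (f := fun _ => 1) continuous_const).congr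
    (Eventually.of_forall fun θ => ?_)
  simp only [one_mul, density]
  rw [ENNReal.toReal_ofReal (boltzmannFactor_nonneg β θ), real_smul, mul_comm]

theorem morris_eq_integral (A D : ℂ) {β : ℝ} (hβ : 0 < β) (N : ℕ) :
    morris A D β N = ∫ θ : Fin N → ℝ, ∏ l, weight A D (θ l) ∂boltzmannMeasure β N :=
  (integral_boltzmannMeasure hβ _).symm

/-- Laplace's principle needs mass near the maximum point `0`, although for `N ≥ 2` the density
itself vanishes there. -/
theorem boltzmannMeasure_pos {β : ℝ} (hβ : 0 < β) {N : ℕ} {u : Set (Fin N → ℝ)} (hu : IsOpen u)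
    (h0 : 0 ∈ u) : 0 < boltzmannMeasure β N u := by
  rw [pos_iff_ne_zero, boltzmannMeasure_eq, Ne,
    withDensity_apply_eq_zero (measurable_boltzmannDensity hβ N)]
  intro hzero
  set V : Set (Fin N → ℝ) := u ∩ ((Set.univ.pi fun _ => Set.Ioo (-Real.pi) Real.pi) ∩
    {θ | boltzmannFactor β N θ ≠ 0}) with hV
  have hVo : IsOpen V := hu.inter ((isOpen_set_pi Set.finite_univ fun _ _ => isOpen_Ioo).inter
    (isOpen_ne_fun (continuous_boltzmannFactor hβ N) continuous_const))
  have hVn : V.Nonempty := by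
    -- The angles `ε, 2ε, …, Nε` are distinct, so the density is positive there, and they tend to
    -- the origin with `ε`.
    have hc : Continuous fun (ε : ℝ) (l : Fin N) => ε * ((l : ℝ) + 1) := by fun_prop
    have h1 : ∀ᶠ ε in 𝓝[>] (0 : ℝ), (fun l : Fin N => ε * ((l : ℝ) + 1)) ∈ u := by
      refine (hc.tendsto 0).eventually ?_ |>.filter_mono nhdsWithin_le_nhds
      refine hu.mem_nhds ?_
      simpa using! h0
    have h2 : ∀ᶠ ε in 𝓝[>] (0 : ℝ), ε * ((N : ℝ) + 1) < Real.pi := by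
      have : Continuous fun ε : ℝ => ε * ((N : ℝ) + 1) := by fun_prop
      refine ((this.tendsto 0).eventually (gt_mem_nhds ?_)).filter_mono nhdsWithin_le_nhds
      simpa using Real.pi_pos
    obtain ⟨ε, ⟨hε1, hε2⟩, hε⟩ := ((h1.and h2).and self_mem_nhdsWithin).exists
    have hε : 0 < ε := hε
    have hlt (l : Fin N) : ε * ((l : ℝ) + 1) < Real.pi := by
      refine lt_of_le_of_lt ?_ hε2
      gcongr
      exact l.2.le
    have hpos (l : Fin N) : 0 < ε * ((l : ℝ) + 1) := by positivity
    refine ⟨_, hε1, fun l _ => ⟨by linarith [hpos l, Real.pi_pos], hlt l⟩, ?_⟩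
    refine Finset.prod_ne_zero_iff.2 fun j _ => Finset.prod_ne_zero_iff.2 fun k hk => ?_
    refine (Real.rpow_pos_of_pos ?_ _).ne'
    change 0 < ‖circ _ - circ _‖
    rw [norm_circ_sub_circ, chord]
    refine abs_pos.2 (mul_ne_zero two_ne_zero (Real.sin_pos_of_pos_of_lt_pi ?_ ?_).ne')
    · have : (j : ℝ) < k := by exact_mod_cast Finset.mem_Ioi.1 hk
      have : 0 < ε * ((k : ℝ) - j) := mul_pos hε (by linarith)
      linarith
    · change (ε * ((k : ℝ) + 1) - ε * ((j : ℝ) + 1)) / 2 < Real.pi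
      linarith [hlt k, hpos j, Real.pi_pos]
  have hsub : V ⊆ {θ | ENNReal.ofReal (boltzmannFactor β N θ) ≠ 0} ∩ u := by
    rintro θ ⟨hθu, -, hθ⟩
    refine ⟨?_, hθu⟩
    simpa using lt_of_le_of_ne (boltzmannFactor_nonneg β θ) (Ne.symm hθ)
  have hVz := measure_mono_null hsub hzero
  rw [cubeMeasure_eq, Measure.restrict_apply hVo.measurableSet, Set.inter_eq_left.2] at hVz
  · exact (hVo.measure_pos volume hVn).ne' hVz
  · rintro θ ⟨-, hθ, -⟩ l _
    exact Set.Ioo_subset_Ioc_self (hθ l trivial)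

theorem morris_zero_ne_zero {β : ℝ} (hβ : 0 < β) (N : ℕ) : morris 0 0 β N ≠ 0 := by
  have := isFiniteMeasure_boltzmannMeasure hβ N
  rw [morris_eq_integral 0 0 hβ]
  simp only [weight, cpow_zero, mul_zero, zero_mul, zero_div, exp_zero, mul_one,
    Finset.prod_const_one, integral_const, real_smul, ne_eq, ofReal_eq_zero]
  exact (ENNReal.toReal_pos (boltzmannMeasure_pos hβ isOpen_univ trivial).ne' (measure_ne_top _ _)).ne'

theorem norm_pow_mul_weight {A : ℂ} (hA : -1 < A.re) (D : ℂ) (n : ℕ) (t : ℝ) :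
    ((‖1 + circ t‖ ^ 2 : ℝ) : ℂ) ^ n * weight A D t = weight (A + 2 * n) D t := by
  rcases n.eq_zero_or_pos with rfl | hn
  · simp
  rw [weight, weight]
  by_cases h0 : ((‖1 + circ t‖ : ℝ) : ℂ) = 0
  · have hA2 : A + 2 * n ≠ 0 := fun h => by
      have := congrArg re h
      simp at this
      have h1 : (1 : ℝ) ≤ n := by exact_mod_cast hn
      linarith
    rw [ofReal_pow, h0, zero_cpow hA2]
    simp [hn.ne']
  · rw [cpow_add _ _ h0, ofReal_pow, ← pow_mul,
      show (2 : ℂ) * n = ((2 * n : ℕ) : ℂ) by push_cast; rfl, cpow_natCast]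
    ring

/-- The product of `|1 + e^{iθ_l}|²` has its unique maximum on the closed cube at `0`. Its
normalised `n`-th powers therefore concentrate there, and the weight at `0` is `2^A`. -/
theorem tendsto_morris_div {A : ℂ} (hA : -1 < A.re) (D : ℂ) {β : ℝ} (hβ : 0 < β) (N : ℕ) :
    Tendsto (fun n : ℕ => morris (A + 2 * n) D β N / morris (2 * n) 0 β N) atTop
      (𝓝 (((2 : ℂ) ^ A) ^ N)) := by
  have := isFiniteMeasure_boltzmannMeasure hβ N
  set s : Set (Fin N → ℝ) := Set.univ.pi fun _ => Set.Icc (-Real.pi) Real.pi with hs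
  set c : (Fin N → ℝ) → ℝ := fun θ => ∏ l, ‖1 + circ (θ l)‖ ^ 2 with hc
  have hae : ∀ᵐ θ ∂boltzmannMeasure β N, θ ∈ s := by
    rw [boltzmannMeasure_eq]
    refine (withDensity_absolutelyContinuous _ _).ae_le ?_
    exact (ae_cubeMeasure_mem N).mono fun θ hθ l _ => Set.Ioc_subset_Icc_self (hθ l)
  have hrestr := Measure.restrict_eq_self_of_ae_mem hae
  have hcirc : circ 0 = 1 := by simp [circ]
  have hcc : Continuous c := continuous_finsetProd _ fun l _ =>
    (continuous_const.add (continuous_circ.comp (continuous_apply l))).norm.pow 2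
  have hfac (t : ℝ) : ‖1 + circ t‖ ^ 2 ≤ ‖1 + circ 0‖ ^ 2 := by
    rw [hcirc]
    refine pow_le_pow_left₀ (norm_nonneg _) ((norm_one_add_circ_le t).trans ?_) 2
    norm_num
  have hfac' {t : ℝ} (ht : t ∈ Set.Icc (-Real.pi) Real.pi) (h0 : t ≠ 0) :
      ‖1 + circ t‖ ^ 2 < ‖1 + circ 0‖ ^ 2 := by
    rw [hcirc, norm_one_add_circ_of_mem ht]
    have h1 : Real.cos (t / 2) ≠ 1 := fun h => h0 (by
      have := (Real.cos_eq_one_iff_of_lt_of_lt (by linarith [ht.1, Real.pi_pos])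
        (by linarith [ht.2, Real.pi_pos])).1 h
      linarith)
    have h2 : Real.cos (t / 2) < 1 := lt_of_le_of_ne (Real.cos_le_one _) h1
    have h3 : 0 ≤ Real.cos (t / 2) :=
      Real.cos_nonneg_of_neg_pi_div_two_le_of_le (by linarith [ht.1]) (by linarith [ht.2])
    refine pow_lt_pow_left₀ (lt_of_lt_of_eq (by linarith : 2 * Real.cos (t / 2) < 2) ?_)
      (by linarith) two_ne_zero
    norm_num
  have h0pos : 0 < ‖1 + circ 0‖ ^ 2 := by rw [hcirc]; norm_num
  have hc0 : 0 < c 0 := Finset.prod_pos fun l _ => h0pos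
  have hmax : ∀ θ ∈ s, θ ≠ 0 → c θ < c 0 := by
    intro θ hθ hne
    by_cases hz : ∀ l, 0 < ‖1 + circ (θ l)‖ ^ 2
    · obtain ⟨l, hl⟩ := Function.ne_iff.1 hne
      exact Finset.prod_lt_prod (fun l _ => hz l) (fun l _ => hfac _)
        ⟨l, Finset.mem_univ _, hfac' (hθ l trivial) hl⟩
    · push Not at hz
      obtain ⟨l, hl⟩ := hz
      have : c θ = 0 := Finset.prod_eq_zero (Finset.mem_univ l) (le_antisymm hl (by positivity))
      rw [this]; exact hc0
  have hw : ContinuousAt (weight A D) 0 := by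
    unfold weight
    refine ContinuousAt.mul (by fun_prop) (ContinuousAt.cpow ?_ continuousAt_const ?_)
    · exact (continuous_ofReal.comp (continuous_const.add continuous_circ).norm).continuousAt
    · rw [hcirc, ofReal_mem_slitPlane]; norm_num
  have hg : ContinuousAt (fun θ : Fin N → ℝ => ∏ l, weight A D (θ l)) 0 :=
    tendsto_finsetProd _ fun l _ => hw.tendsto.comp (continuous_apply l).continuousAt
  have key := tendsto_setIntegral_pow_smul_of_unique_maximum_of_isCompact_of_measure_nhdsWithin_pos
    (μ := boltzmannMeasure β N) (x₀ := (0 : Fin N → ℝ))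
    (isCompact_univ_pi fun _ : Fin N => isCompact_Icc (a := -Real.pi) (b := Real.pi))
    (fun u hu h0 => by
      rw [← Measure.restrict_apply hu.measurableSet, hrestr]
      exact boltzmannMeasure_pos hβ hu h0)
    hcc.continuousOn hmax (fun θ _ => Finset.prod_nonneg fun _ _ => by positivity) hc0
    (fun l _ => ⟨by simpa using Real.pi_pos.le, Real.pi_pos.le⟩)
    (integrable_boltzmannMeasure hA D hβ N).integrableOn hg.continuousWithinAt
  have hval : ∏ l : Fin N, weight A D ((0 : Fin N → ℝ) l) = ((2 : ℂ) ^ A) ^ N := by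
    simp [weight, hcirc]
    norm_num
  rw [hval] at key
  refine key.congr fun n => ?_
  rw [hrestr, morris_eq_integral _ _ hβ, morris_eq_integral _ _ hβ]
  have e1 (θ : Fin N → ℝ) : c θ ^ n • ∏ l, weight A D (θ l) = ∏ l, weight (A + 2 * n) D (θ l) := by
    rw [real_smul, hc, ofReal_pow, ofReal_prod, ← Finset.prod_pow, ← Finset.prod_mul_distrib]
    exact Finset.prod_congr rfl fun l _ => norm_pow_mul_weight hA D n _
  have e2 (θ : Fin N → ℝ) : ((c θ ^ n : ℝ) : ℂ) = ∏ l, weight (2 * n) 0 (θ l) := by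
    rw [hc, ofReal_pow, ofReal_prod, ← Finset.prod_pow]
    refine Finset.prod_congr rfl fun l _ => ?_
    have := norm_pow_mul_weight (A := 0) (by simp) 0 n (θ l)
    rw [zero_add] at this
    rw [← this]
    simp [weight]
  have e3 : ∫ θ, ((c θ ^ n : ℝ) : ℂ) ∂boltzmannMeasure β N =
      ((∫ θ, c θ ^ n ∂boltzmannMeasure β N : ℝ) : ℂ) := integral_ofReal
  simp only [e1, ← e2]
  rw [e3, real_smul, ofReal_inv, div_eq_inv_mul]

/-! ### The Morris integral -/

/-- The product of Gamma values in the Morris integral. -/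
noncomputable def morrisProd (A D : ℂ) (β : ℝ) (N : ℕ) : ℂ :=
  ∏ j ∈ Finset.range N, (Gamma (β / 2 * j + A + 1) * Gamma (β / 2 * j + 1) *
    ((Gamma (β / 2 * j + (A + D) / 2 + 1))⁻¹ * (Gamma (β / 2 * j + (A - D) / 2 + 1))⁻¹))

theorem shift_ne_zero {A : ℂ} (hA : -1 < A.re) {β : ℝ} (hβ : 0 < β) (j : ℕ) :
    A + 1 + β / 2 * j ≠ 0 := fun h => by
  have h2 := congrArg re h
  rw [← ofReal_ofNat, ← ofReal_div, ← ofReal_natCast, ← ofReal_mul, add_re, ofReal_re] at h2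
  simp at h2
  have : 0 ≤ β / 2 * j := by positivity
  linarith

theorem morrisProd_add_two {A : ℂ} (hA : -1 < A.re) (D : ℂ) {β : ℝ} (hβ : 0 < β) (N : ℕ) :
    (∏ j ∈ Finset.range N, (((A + D) / 2 + 1 + β / 2 * j) * ((A - D) / 2 + 1 + β / 2 * j))) *
      morrisProd (A + 2) D β N =
      (∏ j ∈ Finset.range N, ((A + 1 + β / 2 * j) * (A + 2 + β / 2 * j))) * morrisProd A D β N := by
  rw [morrisProd, morrisProd, ← Finset.prod_mul_distrib, ← Finset.prod_mul_distrib]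
  refine Finset.prod_congr rfl fun j _ => ?_
  have h1 := shift_ne_zero hA hβ j
  have h2 := shift_ne_zero (A := A + 1) (by simp; linarith) hβ j
  have e1 : Gamma (β / 2 * j + (A + 2) + 1) =
      (A + 2 + β / 2 * j) * ((A + 1 + β / 2 * j) * Gamma (β / 2 * j + A + 1)) := by
    rw [show β / 2 * j + A + 1 = A + 1 + β / 2 * j by ring, ← Gamma_add_one _ h1,
      show A + 1 + (β : ℂ) / 2 * j + 1 = A + 1 + 1 + β / 2 * j by ring,
      show A + 2 + (β : ℂ) / 2 * j = A + 1 + 1 + β / 2 * j by ring, ← Gamma_add_one _ h2]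
    congr 1; ring
  have e2 (x : ℂ) : (Gamma (β / 2 * j + x + 1))⁻¹ =
      (x + 1 + β / 2 * j) * (Gamma (β / 2 * j + (x + 1) + 1))⁻¹ := by
    rw [Complex.one_div_Gamma_eq_self_mul_one_div_Gamma_add_one]
    rw [show (β : ℂ) / 2 * j + x + 1 = x + 1 + β / 2 * j by ring]
    congr 3; ring
  rw [e1, e2 ((A + D) / 2), e2 ((A - D) / 2), show (A + 2 + D) / 2 = (A + D) / 2 + 1 by ring,
    show (A + 2 - D) / 2 = (A - D) / 2 + 1 by ring]
  ring

/-- A common multiplier `c` avoids dividing by the factors in `(A ± D)/2`, which may vanish. -/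
theorem exists_morris_eq {A : ℂ} (hA : -1 < A.re) (D : ℂ) {β : ℝ} (hβ : 0 < β) (N n : ℕ) :
    ∃ c : ℂ, morris A D β N = c * morris (A + 2 * n) D β N ∧
      morrisProd A D β N = c * morrisProd (A + 2 * n) D β N := by
  induction n with
  | zero => exact ⟨1, by simp⟩
  | succ n ih =>
    obtain ⟨c, h1, h2⟩ := ih
    have hA' : -1 < (A + 2 * n).re := by
      simp
      linarith [n.cast_nonneg (α := ℝ)]
    set B := A + 2 * n
    have hQ : ∏ j ∈ Finset.range N, ((B + 1 + β / 2 * j) * (B + 2 + β / 2 * j)) ≠ 0 :=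
      Finset.prod_ne_zero_iff.2 fun j _ => mul_ne_zero (shift_ne_zero hA' hβ j) (by
        have := shift_ne_zero (A := B + 1) (by simp; linarith) hβ j
        rwa [show B + 2 + (β : ℂ) / 2 * j = B + 1 + 1 + β / 2 * j by ring])
    have e : A + 2 * ((n + 1 : ℕ) : ℂ) = B + 2 := by simp only [B]; push_cast; ring
    refine ⟨c * ((∏ j ∈ Finset.range N, (((B + D) / 2 + 1 + β / 2 * j) *
      ((B - D) / 2 + 1 + β / 2 * j))) /
      ∏ j ∈ Finset.range N, ((B + 1 + β / 2 * j) * (B + 2 + β / 2 * j))), ?_, ?_⟩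
    · rw [h1, e, mul_assoc, div_mul_eq_mul_div, morris_add_two hA' D hβ, mul_div_cancel_left₀ _ hQ]
    · rw [h2, e, mul_assoc, div_mul_eq_mul_div, morrisProd_add_two hA' D hβ,
        mul_div_cancel_left₀ _ hQ]

theorem tendsto_gamma_ratio (w z : ℂ) : Tendsto
    (fun n : ℕ => Gamma (n + 1 + (w + z)) / (Gamma (n + 1 + w) * (n : ℂ) ^ z)) atTop (𝓝 1) := by
  have h := (tendsto_gammaQuot (w + z)).div (tendsto_gammaQuot w) one_ne_zero
  rw [div_one] at h
  refine h.congr' ?_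
  filter_upwards [eventually_ne_atTop 0] with n hn
  have hn' : (n : ℂ) ≠ 0 := by exact_mod_cast hn
  have h1 : (n.factorial : ℂ) ≠ 0 := by exact_mod_cast n.factorial_ne_zero
  have h2 : (n : ℂ) ^ w ≠ 0 := by simp [cpow_eq_zero_iff, hn]
  have h3 : (n : ℂ) ^ z ≠ 0 := by simp [cpow_eq_zero_iff, hn]
  rw [Pi.div_apply, gamma_natCast_add_eq w hn, gamma_natCast_add_eq (w + z) hn, cpow_add _ _ hn']
  field_simp

/-- Each index contributes `(2n)^A` against `n^{(A+D)/2} n^{(A-D)/2}`, hence `2^A` in the limit. -/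
theorem tendsto_morrisProd_div (A D : ℂ) {β : ℝ} (hβ : 0 < β) (N : ℕ) :
    Tendsto (fun n : ℕ => morrisProd (A + 2 * n) D β N / morrisProd (2 * n) 0 β N) atTop
      (𝓝 (((2 : ℂ) ^ A) ^ N)) := by
  have hlim : Tendsto (fun n : ℕ => ∏ j ∈ Finset.range N,
      ((Gamma (β / 2 * j + (A + 2 * n) + 1) * Gamma (β / 2 * j + 1) *
        ((Gamma (β / 2 * j + (A + 2 * n + D) / 2 + 1))⁻¹ *
          (Gamma (β / 2 * j + (A + 2 * n - D) / 2 + 1))⁻¹)) /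
      (Gamma (β / 2 * j + 2 * n + 1) * Gamma (β / 2 * j + 1) *
        ((Gamma (β / 2 * j + (2 * n + 0) / 2 + 1))⁻¹ *
          (Gamma (β / 2 * j + (2 * n - 0) / 2 + 1))⁻¹)))) atTop
      (𝓝 (∏ j ∈ Finset.range N, (2 : ℂ) ^ A)) := by
    refine tendsto_finsetProd _ fun j _ => ?_
    set w : ℂ := β / 2 * j with hw
    have t1 := (tendsto_gamma_ratio w A).comp (tendsto_id.const_mul_atTop' two_pos)
    have t2 := (tendsto_gamma_ratio w ((A + D) / 2)).inv₀ one_ne_zero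
    have t3 := (tendsto_gamma_ratio w ((A - D) / 2)).inv₀ one_ne_zero
    have t := ((t1.mul t2).mul t3).const_mul ((2 : ℂ) ^ A)
    rw [inv_one, mul_one, mul_one, mul_one] at t
    refine t.congr' ?_
    filter_upwards [eventually_ne_atTop 0] with n hn
    have hn' : (n : ℂ) ≠ 0 := by exact_mod_cast hn
    have hwpos (m : ℕ) : Gamma (m + 1 + w) ≠ 0 := by
      refine Gamma_ne_zero_of_re_pos ?_
      have : (m : ℂ) + 1 + w = ((m + 1 + β / 2 * j : ℝ) : ℂ) := by rw [hw]; push_cast; ring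
      rw [this, ofReal_re]
      positivity
    have g0 := hwpos 0
    have g1 := hwpos n
    have g2 := hwpos (2 * n)
    push_cast at g0 g2
    have p1 : (n : ℂ) ^ ((A + D) / 2) ≠ 0 := by simp [cpow_eq_zero_iff, hn]
    have p2 : (n : ℂ) ^ ((A - D) / 2) ≠ 0 := by simp [cpow_eq_zero_iff, hn]
    have p3 : (2 : ℂ) ^ A ≠ 0 := by simp [cpow_eq_zero_iff]
    have ep : (((2 * n : ℕ) : ℂ)) ^ A = 2 ^ A * (n ^ ((A + D) / 2) * n ^ ((A - D) / 2)) := by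
      rw [← cpow_add _ _ hn', Nat.cast_mul, natCast_mul_natCast_cpow]
      congr 2; ring
    simp only [Function.comp, id, ep]
    rw [show w + (A + 2 * n) + 1 = ((2 * n : ℕ) : ℂ) + 1 + (w + A) by push_cast; ring,
      show w + (A + 2 * n + D) / 2 + 1 = n + 1 + (w + (A + D) / 2) by ring,
      show w + (A + 2 * n - D) / 2 + 1 = n + 1 + (w + (A - D) / 2) by ring,
      show w + 2 * n + 1 = 2 * n + 1 + w by ring, show w + (2 * n + 0) / 2 + 1 = n + 1 + w by ring,
      show w + (2 * n - 0) / 2 + 1 = n + 1 + w by ring,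
      show w + 1 = 0 + 1 + w by ring]
    simp only [div_eq_mul_inv, mul_inv, inv_inv]
    push_cast
    field_simp
  rw [Finset.prod_const, Finset.card_range] at hlim
  refine hlim.congr fun n => ?_
  rw [Finset.prod_div_distrib]
  rfl

/-- The **Morris integral**, normalised by its value at the origin. -/
theorem morris_eq {A : ℂ} (hA : -1 < A.re) (D : ℂ) {β : ℝ} (hβ : 0 < β) (N : ℕ) :
    morris A D β N = morrisProd A D β N * morris 0 0 β N := by
  have h00 := morris_zero_ne_zero hβ N
  -- The reference sequence descends by the recursion to `A = D = 0`, where the Gamma product is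
  -- `1`.
  have hp (n : ℕ) : morris (2 * n) 0 β N = morrisProd (2 * n) 0 β N * morris 0 0 β N := by
    obtain ⟨c, h1, h2⟩ := exists_morris_eq (A := 0) (by simp) 0 hβ N n
    have : morrisProd 0 0 β N = 1 := by
      refine Finset.prod_eq_one fun j _ => ?_
      have : Gamma (β / 2 * j + 1) ≠ 0 := by
        refine Gamma_ne_zero_of_re_pos ?_
        have : (β : ℂ) / 2 * j + 1 = ((β / 2 * j + 1 : ℝ) : ℂ) := by push_cast; ring
        rw [this, ofReal_re]
        positivity
      simp only [add_zero, sub_zero, zero_div]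
      generalize Gamma ((β : ℂ) / 2 * j + 1) = g at *
      field_simp
    rw [zero_add] at h1 h2
    rw [h1, mul_left_comm, ← mul_assoc, ← h2, this, one_mul]
  have t1 := (tendsto_morrisProd_div A D hβ N).const_mul (morris A D β N)
  have t2 := (tendsto_morris_div hA D hβ N).const_mul (morrisProd A D β N * morris 0 0 β N)
  have h2 : ((2 : ℂ) ^ A) ^ N ≠ 0 := pow_ne_zero _ (by simp [cpow_eq_zero_iff])
  refine mul_right_cancel₀ h2 (tendsto_nhds_unique t1 (t2.congr fun n => ?_))
  -- After extraction of the common `c` the two sequences agree term by term, so their limits do.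
  obtain ⟨c, hc1, hc2⟩ := exists_morris_eq hA D hβ N n
  rw [hc1, hc2, hp]
  by_cases hz : morrisProd (2 * n) 0 β N = 0
  · simp [hz]
  · field_simp

/-! ### The averages -/

theorem ne_top_inv_boltzmannMeasure {β : ℝ} (hβ : 0 < β) (N : ℕ) :
    (boltzmannMeasure β N Set.univ)⁻¹ ≠ ⊤ :=
  ENNReal.inv_ne_top.2 (boltzmannMeasure_pos hβ isOpen_univ trivial).ne'

theorem integrable_prod_symbol {β : ℝ} (hβ : 0 < β) {q : ℂ} (hq : -1 < β * q.re) (b : ℂ) (N : ℕ) :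
    Integrable (fun θ : Fin N → ℝ => ∏ l, symbol β q b (θ l)) (ensemble β N) := by
  rw [ensemble, symbol_eq_weight]
  exact (integrable_boltzmannMeasure (by simpa using hq) _ hβ N).smul_measure
    (ne_top_inv_boltzmannMeasure hβ N)

theorem integral_prod_symbol {β : ℝ} (hβ : 0 < β) {q : ℂ} (hq : -1 < β * q.re) (b : ℂ) (N : ℕ) :
    ∫ θ : Fin N → ℝ, ∏ l, symbol β q b (θ l) ∂ensemble β N = morrisProd (β * q) (β * b) β N := by
  rw [ensemble, symbol_eq_weight, integral_smul_measure, ← morris_eq_integral _ _ hβ,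
    morris_eq (by simpa using hq) _ hβ, real_smul]
  have h0 := morris_zero_ne_zero hβ N
  have h1 : morris 0 0 β N = ((boltzmannMeasure β N Set.univ).toReal : ℂ) := by
    rw [morris_eq_integral 0 0 hβ]
    simp [weight, Measure.real]
  rw [ENNReal.toReal_inv, ofReal_inv, ← h1]
  field_simp

theorem prod_range_mul_eq (r n : ℕ) (g : ℕ → ℂ) :
    ∏ j ∈ Finset.range (r * n), g j =
      ∏ ν ∈ Finset.range r, ∏ t ∈ Finset.range n, g (r * t + ν) := by
  induction n with
  | zero => simp
  | succ n ih =>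
    rw [mul_add_one, Finset.prod_range_add, ih]
    simp_rw [Finset.prod_range_succ, Finset.prod_mul_distrib]

/-- The cross ratio of four values of `Γ`. -/
noncomputable def gammaCross (z₁ z₂ z₃ z₄ : ℂ) : ℂ :=
  Gamma z₁ * Gamma z₂ * ((Gamma z₃)⁻¹ * (Gamma z₄)⁻¹)

/-- The balance of the arguments cancels the powers of `s`, and the unknown constant occurs twice
above and twice below; Gauss multiplication up to a constant is enough. -/
theorem gammaCross_mul {s : ℕ} (hs : 0 < s) {z₁ z₂ z₃ z₄ : ℂ} (h : z₁ + z₂ = z₃ + z₄) :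
    gammaCross (s * z₁) (s * z₂) (s * z₃) (s * z₄) =
      ∏ k ∈ Finset.range s, gammaCross (z₁ + k / s) (z₂ + k / s) (z₃ + k / s) (z₄ + k / s) := by
  obtain ⟨C, hC, hmul⟩ := exists_gamma_mul_eq hs
  have hs' : (s : ℂ) ≠ 0 := by exact_mod_cast hs.ne'
  have h3 (z : ℂ) : (s : ℂ) ^ z ≠ 0 := by simp [cpow_eq_zero_iff, hs']
  have e : (s : ℂ) ^ (s * z₁) * (s : ℂ) ^ (s * z₂) = (s : ℂ) ^ (s * z₃) * (s : ℂ) ^ (s * z₄) := by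
    rw [← cpow_add _ _ hs', ← cpow_add _ _ hs', ← mul_add, ← mul_add, h]
  simp only [gammaCross, Finset.prod_mul_distrib, Finset.prod_inv_distrib, hmul]
  change _ = gammaProd s z₁ * gammaProd s z₂ * ((gammaProd s z₃)⁻¹ * (gammaProd s z₄)⁻¹)
  have e3 := h3 (s * z₃)
  have e4 := h3 (s * z₄)
  calc _ = (C * C⁻¹) * (C * C⁻¹) * ((s : ℂ) ^ (s * z₁) * (s : ℂ) ^ (s * z₂)) *
        (((s : ℂ) ^ (s * z₃))⁻¹ * ((s : ℂ) ^ (s * z₄))⁻¹) *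
        (gammaProd s z₁ * gammaProd s z₂ * ((gammaProd s z₃)⁻¹ * (gammaProd s z₄)⁻¹)) := by
        simp only [mul_inv]; ring
    _ = _ := by
        rw [e, mul_inv_cancel₀ hC]
        field_simp

theorem gammaCross_mul_reflect {s : ℕ} (hs : 0 < s) {z₁ z₂ z₃ z₄ : ℂ} (h : z₁ + z₂ = z₃ + z₄) :
    gammaCross (s * z₁ + 1) (s * z₂ + 1) (s * z₃ + 1) (s * z₄ + 1) =
      ∏ p ∈ Finset.range s, gammaCross (z₁ - p / s + 1) (z₂ - p / s + 1) (z₃ - p / s + 1)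
        (z₄ - p / s + 1) := by
  have hs' : (s : ℂ) ≠ 0 := by exact_mod_cast hs.ne'
  have e (z : ℂ) : s * z + 1 = s * (z + 1 / s) := by field_simp
  rw [e, e, e, e, gammaCross_mul hs (by linear_combination h), ← Finset.prod_range_reflect]
  refine Finset.prod_congr rfl fun p hp => ?_
  have hp' : p + 1 ≤ s := Finset.mem_range.1 hp
  have e2 (z : ℂ) : z + 1 / s + ((s - 1 - p : ℕ) : ℂ) / s = z - p / s + 1 := by
    rw [Nat.sub_sub, Nat.cast_sub (by omega)]
    push_cast
    field_simp
    ring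
  rw [e2, e2, e2, e2]

/-- The exponent of `barnesScale` is quadratic in `w`. In the cross ratio the linear parts cancel
and `(x+y+c)² + c² - (x+c)² - (y+c)² = 2xy`. -/
theorem prod_gammaCross_isEquivalent (x y c : ℂ) :
    (fun n : ℕ => ∏ t ∈ Finset.range n, gammaCross (t + 1 + (x + y + c)) (t + 1 + c)
      (t + 1 + (x + c)) (t + 1 + (y + c))) ~[atTop]
      fun n => exp (x * y * log n) * ((barnesG (x + c + 1) * barnesG (y + c + 1)) /
        (barnesG (x + y + c + 1) * barnesG (c + 1))) := by
  have h := ((prod_inv_gamma_isEquivalent (x + y + c)).inv.mul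
    (prod_inv_gamma_isEquivalent c).inv).mul
    ((prod_inv_gamma_isEquivalent (x + c)).mul (prod_inv_gamma_isEquivalent (y + c)))
  refine (h.congr_left ?_).congr_right ?_
  · refine Eventually.of_forall fun n => ?_
    simp only [Pi.mul_apply, Pi.inv_apply, gammaCross, Finset.prod_mul_distrib,
      Finset.prod_inv_distrib, inv_inv]
  · refine Eventually.of_forall fun n => ?_
    have hL : barnesScale (x + y + c) n * barnesScale c n =
        exp (x * y * log n) * (barnesScale (x + c) n * barnesScale (y + c) n) := by
      simp only [barnesScale]
      generalize (n.factorial : ℂ) ^ n / (∏ k ∈ Finset.range n, ((k : ℂ) + 1) ^ (k + 1)) = H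
      generalize (n : ℂ) * log n - n + log (2 * Real.pi) / 2 = ℓ
      generalize log (n : ℂ) = L
      have : exp ((x + y + c) * ℓ + (x + y + c) ^ 2 / 2 * L) * exp (c * ℓ + c ^ 2 / 2 * L) =
          exp (x * y * L) * (exp ((x + c) * ℓ + (x + c) ^ 2 / 2 * L) *
            exp ((y + c) * ℓ + (y + c) ^ 2 / 2 * L)) := by
        rw [← exp_add, ← exp_add, ← exp_add]
        congr 1; ring
      linear_combination H ^ 2 * this
    have h3 := barnesScale_ne_zero (x + c) n
    have h4 := barnesScale_ne_zero (y + c) n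
    simp only [Pi.mul_apply, Pi.inv_apply, mul_inv, inv_inv, div_eq_mul_inv]
    calc _ = (barnesScale (x + y + c) n * barnesScale c n) *
          ((barnesScale (x + c) n)⁻¹ * (barnesScale (y + c) n)⁻¹) *
          (barnesG (x + c + 1) * barnesG (y + c + 1) *
            ((barnesG (x + y + c + 1))⁻¹ * (barnesG (c + 1))⁻¹)) := by ring
      _ = _ := by
        rw [hL]
        field_simp

/-- For `j = rt + ν` one has `βj/2 = s(t + ν/r)` and `βq = s(2q/r)`, so every Gamma argument has the
form `sz + 1`. -/
theorem morrisProd_eq {r s : ℕ} (hr : 0 < r) (hs : 0 < s) {β : ℝ}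
    (hβ : β / 2 = (s : ℝ) / (r : ℝ)) (q b : ℂ) (n : ℕ) :
    morrisProd (β * q) (β * b) β (r * n) =
      ∏ ν ∈ Finset.range r, ∏ p ∈ Finset.range s, ∏ t ∈ Finset.range n,
        gammaCross (t + 1 + ((q + b) / r + (q - b) / r + (ν / r - p / s)))
          (t + 1 + ((ν : ℂ) / r - p / s)) (t + 1 + ((q + b) / r + (ν / r - p / s)))
          (t + 1 + ((q - b) / r + (ν / r - p / s))) := by
  have hr' : (r : ℂ) ≠ 0 := by exact_mod_cast hr.ne'
  have hβ' : (β : ℂ) = 2 * (s / r) := by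
    have : β = 2 * ((s : ℝ) / r) := by linarith
    rw [this]; push_cast; rfl
  rw [morrisProd, prod_range_mul_eq]
  refine Finset.prod_congr rfl fun ν _ => ?_
  rw [Finset.prod_comm]
  refine Finset.prod_congr rfl fun t _ => ?_
  have h := gammaCross_mul_reflect hs (z₁ := t + (q + b) / r + (q - b) / r + ν / r)
    (z₂ := t + ν / r) (z₃ := t + (q + b) / r + ν / r) (z₄ := t + (q - b) / r + ν / r) (by ring)
  refine Eq.trans ?_ (h.trans (Finset.prod_congr rfl fun p _ => ?_))
  · rw [gammaCross, hβ']
    congr 3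
    all_goals
      congr 1
      push_cast
      field_simp
      try ring
  · congr 1 <;> ring

theorem morrisProd_isEquivalent {r s : ℕ} (hr : 0 < r) (hs : 0 < s) {β : ℝ}
    (hβ : β / 2 = (s : ℝ) / (r : ℝ)) (q b : ℂ) :
    (fun n : ℕ => morrisProd (β * q) (β * b) β (r * n)) ~[atTop]
      fun n : ℕ => ((r : ℂ) * (n : ℂ)) ^ (((β : ℂ) / 2) * (q ^ 2 - b ^ 2)) * amplitude r s q b := by
  have hr' : (r : ℂ) ≠ 0 := by exact_mod_cast hr.ne'
  have hβ' : (β : ℂ) / 2 = s / r := by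
    have := congrArg ofReal hβ
    push_cast at this
    exact this
  have h := IsEquivalent.finsetProd (s := Finset.range r) fun ν _ =>
    IsEquivalent.finsetProd (s := Finset.range s) fun p _ =>
      prod_gammaCross_isEquivalent ((q + b) / r) ((q - b) / r) ((ν : ℂ) / r - (p : ℂ) / s)
  refine (h.congr_left (Eventually.of_forall fun n => ?_)).congr_right ?_
  · exact (morrisProd_eq hr hs hβ q b n).symm
  filter_upwards [eventually_ne_atTop 0] with n hn
  have hn' : (n : ℂ) ≠ 0 := by exact_mod_cast hn
  have split (E : ℂ) (X : ℕ → ℕ → ℂ) : ∏ ν ∈ Finset.range r, ∏ p ∈ Finset.range s, (E * X ν p) =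
      (E ^ s) ^ r * ∏ ν ∈ Finset.range r, ∏ p ∈ Finset.range s, X ν p := by
    simp only [Finset.prod_mul_distrib, Finset.prod_const, Finset.card_range]
  rw [split, amplitude, natCast_mul_natCast_cpow, hβ', ← exp_nat_mul, ← exp_nat_mul]
  -- Each of the `rs` pairs `(ν, p)` contributes `n` to the power `(q + b)(q - b)/r²`.
  have e1 : (n : ℂ) ^ ((s : ℂ) / r * (q ^ 2 - b ^ 2)) =
      exp (r * (s * ((q + b) / r * ((q - b) / r) * log n))) := by
    rw [cpow_def_of_ne_zero hn']
    congr 1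
    field_simp
    ring
  have e2 : (r : ℂ) ^ ((s : ℂ) / r * (q ^ 2 - b ^ 2)) *
      (r : ℂ) ^ (-((q ^ 2 - b ^ 2) * ((s : ℂ) / r))) = 1 := by
    rw [← cpow_add _ _ hr', mul_comm (q ^ 2 - b ^ 2), add_neg_cancel, cpow_zero]
  rw [e1]
  calc _ = exp (r * (s * ((q + b) / r * ((q - b) / r) * log n))) *
        ∏ ν ∈ Finset.range r, ∏ p ∈ Finset.range s,
      (barnesG ((q + b) / r + (ν : ℂ) / r - (p : ℂ) / s + 1) *
          barnesG ((q - b) / r + (ν : ℂ) / r - (p : ℂ) / s + 1)) /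
        (barnesG (2 * q / r + (ν : ℂ) / r - (p : ℂ) / s + 1) *
          barnesG ((ν : ℂ) / r - (p : ℂ) / s + 1)) := by
        congr 1
        refine Finset.prod_congr rfl fun ν _ => Finset.prod_congr rfl fun p _ => ?_
        congr 3 <;> congr 1 <;> ring
    _ = _ := by
        rw [mul_comm ((r : ℂ) ^ _), mul_assoc (exp _), ← mul_assoc ((r : ℂ) ^ _) ((r : ℂ) ^ _), e2,
          one_mul]

end CircularBeta

theorem mainTheorem3 (r s : ℕ) (hr : 0 < r) (hs : 0 < s) (β : ℝ)
    (hβ : β / 2 = (s : ℝ) / (r : ℝ)) (q b : ℂ) (hq : -1 < β * q.re) :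
    (∀ N : ℕ, Integrable (fun θ : Fin N → ℝ => ∏ l, CircularBeta.symbol β q b (θ l))
      (CircularBeta.ensemble β N)) ∧
    (fun n : ℕ => ∫ θ : Fin (r * n) → ℝ, ∏ l, CircularBeta.symbol β q b (θ l)
      ∂(CircularBeta.ensemble β (r * n)))
    ~[atTop] (fun n : ℕ => ((r : ℂ) * (n : ℂ)) ^ (((β : ℂ) / 2) * (q ^ 2 - b ^ 2)) *
      CircularBeta.amplitude r s q b) := by
  have hpos : 0 < β := by
    have : 0 < (s : ℝ) / r := by positivity
    linarith
  refine ⟨CircularBeta.integrable_prod_symbol hpos hq b, ?_⟩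
  simp only [CircularBeta.integral_prod_symbol hpos hq b]
  exact CircularBeta.morrisProd_isEquivalent hr hs hβ q b
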